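/- Let $n\in\mathbb N$ and $p\in\mathbb R$ satisfy $1<p<n$ and $\frac{2n}{n+2}\le p\le 2$, and put $q=\frac{np}{n-p}$ and $\ell^*_p=\frac{n-p}{p-1}$. Let $\mathcal K:[0,+\infty[\,\to\,]0,+\infty[$ be of class $C^1$. Assume: $(\mathrm H_\ell)$ there are constants $A,B,\ell>0$ such that $\mathcal K(r)=A+Br^{\ell}+h(r)$ for $r\ge 0$, with $\displaystyle\lim_{r\to0^+}\frac{|h(r)|+r|h'(r)|}{r^{\ell}}=0$; $(\mathrm H_\uparrow)$ $\mathcal K$ is increasing (in the weak sense) on $[0,+\infty[$, and strictly increasing on some nondegenerate interval. For $\mathcal R>0$ consider the problem $$\begin{cases}\Delta_p u(x)+\mathcal K(|x|)\,u(x)|u(x)|^{q-2}=0, & |x|<\mathcal R,\\ u(x)>0, & |x|<\mathcal R,\\ u(x)=0, & |x|=\mathcal R,\end{cases}\qquad (P_{\mathcal R})$$ in $\mathbb R^n$, where $\Delta_p u=\operatorname{div}(|\nabla u|^{p-2}\nabla u)$. A radial solution is a function $u$ on the closed ball $\{|x|\le\mathcal R\}$ which depends only on $|x|$, is continuous on the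 closed ball and $C^1$ in the open ball, whose field $|\nabla u|^{p-2}\nabla u$ (read as $0$ where $\nabla u=0$) is differentiable in the open ball, and which satisfies $(P_{\mathcal R})$ pointwise. If $\ell=\ell^*_p$, then there is $\mathcal R_0>0$ such that $(P_{\mathcal R})$ has no radial solution when $0<\mathcal R<\mathcal R_0$, and at least one radial solution when $\mathcal R>\mathcal R_0$. If $\ell>\ell^*_p$, then there is $\mathcal R_0>0$ such that $(P_{\mathcal R})$ has no radial solution when $0<\mathcal R<\mathcal R_0$, at least one radial solution when $\mathcal R=\mathcal R_0$, and at least two distinct radial solutions when $\mathcal R>\mathcal R_0$. -/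

import Mathlib

open Set Filter Topology

noncomputable section

/-- The divergence `∑ᵢ ∂ᵢ Fᵢ` of a vector field on `ℝⁿ`. -/
def divergence {n : ℕ} (F : EuclideanSpace ℝ (Fin n) → EuclideanSpace ℝ (Fin n))
    (x : EuclideanSpace ℝ (Fin n)) : ℝ :=
  ∑ i : Fin n, (fderiv ℝ F x (EuclideanSpace.single i 1)) i

/-- The vector field `|∇u|^{p-2} ∇u`; for `p > 1` it vanishes where `∇u = 0`. -/
def pFlux {n : ℕ} (p : ℝ) (u : EuclideanSpace ℝ (Fin n) → ℝ)
    (x : EuclideanSpace ℝ (Fin n)) : EuclideanSpace ℝ (Fin n) :=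
  ‖gradient u x‖ ^ (p - 2) • gradient u x

/-- The `p`-Laplacian `div (|∇u|^{p-2} ∇u)`. -/
def pLaplacian {n : ℕ} (p : ℝ) (u : EuclideanSpace ℝ (Fin n) → ℝ)
    (x : EuclideanSpace ℝ (Fin n)) : ℝ :=
  divergence (pFlux p u) x

/-- The Sobolev critical exponent `n p / (n - p)`. -/
def sobolevExponent (n : ℕ) (p : ℝ) : ℝ := n * p / (n - p)

/-- The critical order of flatness `(n - p) / (p - 1)`. -/
def criticalFlatness (n : ℕ) (p : ℝ) : ℝ := (n - p) / (p - 1)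

/-- `u` is a radial solution of `Δ_p u + K(|x|) u |u|^{q-2} = 0` in the ball `|x| < R` of `ℝⁿ`,
with `u > 0` for `|x| < R` and `u = 0` for `|x| = R`, where `q` is the critical exponent.
Only the values of `u` on the closed ball matter. -/
structure IsRadialSolution (n : ℕ) (p : ℝ) (K : ℝ → ℝ) (R : ℝ)
    (u : EuclideanSpace ℝ (Fin n) → ℝ) : Prop where
  radial : ∀ x ∈ Metric.closedBall (0 : EuclideanSpace ℝ (Fin n)) R,
    ∀ y ∈ Metric.closedBall (0 : EuclideanSpace ℝ (Fin n)) R, ‖x‖ = ‖y‖ → u x = u y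
  continuousOn : ContinuousOn u (Metric.closedBall 0 R)
  contDiffOn : ContDiffOn ℝ 1 u (Metric.ball 0 R)
  differentiableOn_flux : DifferentiableOn ℝ (pFlux p u) (Metric.ball 0 R)
  equation : ∀ x ∈ Metric.ball (0 : EuclideanSpace ℝ (Fin n)) R,
    pLaplacian p u x + K ‖x‖ * (u x * |u x| ^ (sobolevExponent n p - 2)) = 0
  pos : ∀ x ∈ Metric.ball (0 : EuclideanSpace ℝ (Fin n)) R, 0 < u x
  boundary : ∀ x ∈ Metric.sphere (0 : EuclideanSpace ℝ (Fin n)) R, u x = 0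

/-- There are constants `A, B, ℓ > 0` (here `ℓ` is given) and a function `h` such that
`K(r) = A + B r^ℓ + h(r)` and `(|h(r)| + r |h'(r)|) / r^ℓ → 0` as `r → 0⁺`. -/
def FlatnessCondition (K : ℝ → ℝ) (l : ℝ) : Prop :=
  0 < l ∧ ∃ A B : ℝ, 0 < A ∧ 0 < B ∧ ∃ h : ℝ → ℝ,
    (∀ r, 0 ≤ r → K r = A + B * r ^ l + h r) ∧
    Tendsto (fun r => (|h r| + r * |deriv h r|) / r ^ l) (𝓝[>] 0) (𝓝 0)

/-- `K` is increasing on `[0, ∞)`, strictly on some nondegenerate interval. -/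
def IncreasingCondition (K : ℝ → ℝ) : Prop :=
  MonotoneOn K (Ici 0) ∧ ∃ a b : ℝ, 0 ≤ a ∧ a < b ∧ StrictMonoOn K (Icc a b)

end

/-! The proof is by shooting. With `m = 1/(p-1)`, a radial solution with central value `a` has slope
`u' = -(r G)^m`, where `G(r) = r⁻ⁿ ∫₀ʳ tⁿ⁻¹ K u₊^(q-1)`. The bounds on `p` say `m ≥ 1` and `q ≥ 2`,
so this integral equation is locally Lipschitz: each `a > 0` gives a unique shot, depending
continuously on `a`. Radial solutions in the ball of radius `R` then correspond to the values `a`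
whose shot has first zero `R`, and everything reduces to the shape of the map from `a` to the first
zero.

The main tool is the Pohozaev functional `P`. By criticality of `q` its derivative is `rⁿ K' u^q /
q`, so `P` is nondecreasing from `0` while `u > 0`. Positivity of `P` makes `G u^(-β)` nondecreasing
for `β = (1+γ)/m` (`fluxAvg_ge`), and one more integration bounds `u` by a multiple of `a^(-m)
r^(-ℓ*)`, where `ℓ* = (1+m)/γ` is the critical flatness (`rpow_le_of_pos`, `exists_decay`).

Every shot vanishes somewhere (`exists_nonpos`): as `K` is not constant, `P` stays above a positive
constant from some point on, and for a shot positive forever this forces unbounded growth of the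
flux `rⁿ G`, against the decay bound. The zero is crossed transversally, so it is continuous in `a`
(`exists_zero_map`). It tends to infinity as `a → 0`, where the nonlinearity is weak.

For large `a`, compare two estimates of `P` at the zero `R` (`exists_zero_ge`). The flux at `R` is
at least of order `1/a`, so `P(R)` is at least of order `a^(-(1+m)) R^(-ℓ*)`. Integrating `P'` with
`r K' ≤ C r^ℓ` gives at most order `a^(-γℓ)`. Hence `R^ℓ* ≥ c a^(γℓ-(1+m))` for bounded `R`. If `ℓ =
ℓ*` the exponent is zero, so the first zero is bounded away from `0` and its range is a half-line,
open or closed. If `ℓ > ℓ*` the first zero tends to infinity at both ends, so it attains a minimum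
and takes every larger value at least twice. -/

noncomputable section

/-! ### The weighted average over a ball -/

/-- The average `r⁻ⁿ ∫₀ʳ tⁿ⁻¹ f(t) dt`, written without the singularity at `r = 0`. -/
def ballAvg (n : ℕ) (f : ℝ → ℝ) (r : ℝ) : ℝ := ∫ t in (0 : ℝ)..1, t ^ (n - 1) * f (t * r)

lemma continuous_ballAvg (n : ℕ) {f : ℝ → ℝ} (hf : Continuous f) : Continuous (ballAvg n f) := by
  unfold ballAvg
  apply intervalIntegral.continuous_parametric_intervalIntegral_of_continuous'
  fun_prop

lemma ballAvg_zero {n : ℕ} (hn : 0 < n) (f : ℝ → ℝ) : ballAvg n f 0 = f 0 / n := by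
  obtain ⟨k, rfl⟩ : ∃ k, n = k + 1 := ⟨n - 1, by omega⟩
  simp [ballAvg, integral_pow]
  ring

lemma pow_mul_ballAvg {n : ℕ} (hn : 0 < n) (f : ℝ → ℝ) (r : ℝ) :
    r ^ n * ballAvg n f r = ∫ t in (0 : ℝ)..r, t ^ (n - 1) * f t := by
  obtain ⟨k, rfl⟩ : ∃ k, n = k + 1 := ⟨n - 1, by omega⟩
  rcases eq_or_ne r 0 with rfl | hr
  · simp
  have h := intervalIntegral.integral_comp_mul_right (a := 0) (b := 1)
    (fun t => t ^ k * f t) hr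
  simp only [zero_mul, one_mul, smul_eq_mul] at h
  have h2 : (∫ t in (0 : ℝ)..r, t ^ k * f t) = r * ∫ x in (0 : ℝ)..1, (x * r) ^ k * f (x * r) := by
    rw [h]; field_simp
  simp only [ballAvg, Nat.add_sub_cancel]
  rw [h2, ← intervalIntegral.integral_const_mul, ← intervalIntegral.integral_const_mul]
  congr 1
  ext t
  ring

lemma hasDerivAt_pow_mul_ballAvg {n : ℕ} (hn : 0 < n) {f : ℝ → ℝ} (hf : Continuous f) (r : ℝ) :
    HasDerivAt (fun r => r ^ n * ballAvg n f r) (r ^ (n - 1) * f r) r := by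
  have h : (fun r => r ^ n * ballAvg n f r) = fun r => ∫ t in (0 : ℝ)..r, t ^ (n - 1) * f t :=
    funext fun r => pow_mul_ballAvg hn f r
  rw [h]
  have hc : Continuous fun t => t ^ (n - 1) * f t := by fun_prop
  exact intervalIntegral.integral_hasDerivAt_right (hc.intervalIntegrable _ _)
    (hc.stronglyMeasurableAtFilter _ _) hc.continuousAt

lemma hasDerivAt_ballAvg {n : ℕ} (hn : 0 < n) {f : ℝ → ℝ} (hf : Continuous f) {r : ℝ}
    (hr : r ≠ 0) : HasDerivAt (ballAvg n f) ((f r - n * ballAvg n f r) / r) r := by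
  have h := (hasDerivAt_pow_mul_ballAvg hn hf r).div (hasDerivAt_pow n r) (pow_ne_zero n hr)
  have h2 : ballAvg n f =ᶠ[𝓝 r] (fun r => r ^ n * ballAvg n f r) / fun x => x ^ n := by
    filter_upwards [isOpen_ne.mem_nhds hr] with x hx
    have : x ^ n ≠ 0 := pow_ne_zero n hx
    simp only [Pi.div_apply]
    field_simp
  refine (h.congr_of_eventuallyEq h2).congr_deriv ?_
  obtain ⟨k, rfl⟩ : ∃ k, n = k + 1 := ⟨n - 1, by omega⟩
  simp only [Nat.add_sub_cancel]
  field_simp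
  ring

lemma mul_mem_Icc_of_mem_Icc {t r : ℝ} (ht : t ∈ Icc (0 : ℝ) 1) (hr : 0 ≤ r) :
    t * r ∈ Icc 0 r := ⟨mul_nonneg ht.1 hr, mul_le_of_le_one_left hr ht.2⟩

lemma ballAvg_nonneg (n : ℕ) {f : ℝ → ℝ} {r : ℝ} (hr : 0 ≤ r) (hf : ∀ t ∈ Icc 0 r, 0 ≤ f t) :
    0 ≤ ballAvg n f r :=
  intervalIntegral.integral_nonneg zero_le_one fun _ ht =>
    mul_nonneg (pow_nonneg ht.1 _) (hf _ (mul_mem_Icc_of_mem_Icc ht hr))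

lemma ballAvg_congr (n : ℕ) {f g : ℝ → ℝ} {r : ℝ} (hr : 0 ≤ r) (h : ∀ t ∈ Icc 0 r, f t = g t) :
    ballAvg n f r = ballAvg n g r := by
  refine intervalIntegral.integral_congr fun t ht => ?_
  rw [uIcc_of_le zero_le_one] at ht
  simp only [h _ (mul_mem_Icc_of_mem_Icc ht hr)]

lemma abs_ballAvg_sub_le (n : ℕ) {f g : ℝ → ℝ} (hf : Continuous f) (hg : Continuous g) {r C : ℝ}
    (hr : 0 ≤ r) (h : ∀ t ∈ Icc 0 r, |f t - g t| ≤ C) :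
    |ballAvg n f r - ballAvg n g r| ≤ C := by
  unfold ballAvg
  rw [← intervalIntegral.integral_sub]
  · have := intervalIntegral.norm_integral_le_of_norm_le_const (a := 0) (b := 1) (C := C)
      (f := fun t => t ^ (n - 1) * f (t * r) - t ^ (n - 1) * g (t * r)) ?_
    · simpa using this
    · intro t ht
      rw [uIoc_of_le zero_le_one] at ht
      have ht' : t ∈ Icc (0 : ℝ) 1 := ⟨ht.1.le, ht.2⟩
      rw [← mul_sub, norm_mul, Real.norm_eq_abs, Real.norm_eq_abs]
      have h1 : |t ^ (n - 1)| ≤ 1 := by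
        rw [abs_of_nonneg (pow_nonneg ht.1.le _)]; exact pow_le_one₀ ht.1.le ht.2
      calc _ ≤ 1 * C := mul_le_mul h1 (h _ (mul_mem_Icc_of_mem_Icc ht' hr)) (abs_nonneg _) zero_le_one
        _ = C := one_mul C
  · exact Continuous.intervalIntegrable (by fun_prop) _ _
  · exact Continuous.intervalIntegrable (by fun_prop) _ _

lemma ballAvg_le (n : ℕ) {f : ℝ → ℝ} (hf : Continuous f) {r C : ℝ} (hr : 0 ≤ r)
    (h : ∀ t ∈ Icc 0 r, |f t| ≤ C) : ballAvg n f r ≤ C := by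
  have := abs_ballAvg_sub_le n hf (continuous_const (y := (0 : ℝ))) hr (by simpa using h)
  have h0 : ballAvg n (fun _ => (0 : ℝ)) r = 0 := by simp [ballAvg]
  rw [h0, sub_zero] at this
  exact (le_abs_self _).trans this

/-! ### Truncated powers -/

/-- Truncation of `x` to `[0, Λ]`. -/
def trunc (Λ x : ℝ) : ℝ := max 0 (min x Λ)

lemma continuous_trunc (Λ : ℝ) : Continuous (trunc Λ) := by unfold trunc; fun_prop

lemma trunc_nonneg (Λ x : ℝ) : 0 ≤ trunc Λ x := le_max_left _ _

lemma trunc_le {Λ : ℝ} (hΛ : 0 ≤ Λ) (x : ℝ) : trunc Λ x ≤ Λ := max_le hΛ (min_le_right _ _)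

lemma trunc_of_le {Λ x : ℝ} (hx : x ≤ Λ) : trunc Λ x = max x 0 := by
  rw [trunc, min_eq_left hx, max_comm]

lemma abs_trunc_sub_le (Λ x y : ℝ) : |trunc Λ x - trunc Λ y| ≤ |x - y| := by
  unfold trunc
  have h1 := abs_max_sub_max_le_abs (min x Λ) (min y Λ) 0
  have h2 := abs_min_sub_min_le_max x Λ y Λ
  rw [max_comm 0, max_comm 0]
  refine h1.trans (h2.trans ?_)
  simp

lemma abs_rpow_sub_rpow_le {e B x y : ℝ} (he : 1 ≤ e) (hx : x ∈ Icc 0 B) (hy : y ∈ Icc 0 B) :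
    |x ^ e - y ^ e| ≤ e * B ^ (e - 1) * |x - y| := by
  have := (convex_Icc (0 : ℝ) B).norm_image_sub_le_of_norm_hasDerivWithin_le
    (f := fun x => x ^ e) (f' := fun x => e * x ^ (e - 1)) (C := e * B ^ (e - 1))
    (fun z hz => (Real.hasDerivAt_rpow_const (Or.inr he)).hasDerivWithinAt) ?_ hy hx
  · simpa using this
  · intro z hz
    rw [norm_mul, Real.norm_of_nonneg (by linarith), Real.norm_of_nonneg (Real.rpow_nonneg hz.1 _)]
    have := Real.rpow_le_rpow hz.1 hz.2 (by linarith : 0 ≤ e - 1)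
    gcongr

/-! ### The Volterra equation -/

/-- The slope `-u'(x)` prescribed by the radial equation with truncated nonlinearity. -/
def radialSlope (n : ℕ) (m s Λ : ℝ) (K u : ℝ → ℝ) (x : ℝ) : ℝ :=
  (x * ballAvg n (fun t => K t * trunc Λ (u t) ^ s) x) ^ m

section Volterra

variable {n : ℕ} {m s Λ T : ℝ} {K : ℝ → ℝ}

lemma continuous_source (hs : 1 ≤ s) (hK : Continuous K) {u : ℝ → ℝ} (hu : Continuous u) :
    Continuous fun t => K t * trunc Λ (u t) ^ s :=
  hK.mul (((continuous_trunc Λ).comp hu).rpow_const fun _ => Or.inr (by linarith))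

lemma continuous_radialSlope (hm : 1 ≤ m) (hs : 1 ≤ s) (hK : Continuous K) {u : ℝ → ℝ}
    (hu : Continuous u) : Continuous (radialSlope n m s Λ K u) :=
  (continuous_id.mul (continuous_ballAvg n (continuous_source hs hK hu))).rpow_const
    fun _ => Or.inr (by linarith)

lemma radialSlope_nonneg (hKpos : ∀ r, 0 < K r) (u : ℝ → ℝ) {x : ℝ} (hx : 0 ≤ x) :
    0 ≤ radialSlope n m s Λ K u x :=
  Real.rpow_nonneg (mul_nonneg hx (ballAvg_nonneg n hx fun t _ =>
    mul_nonneg (hKpos t).le (Real.rpow_nonneg (trunc_nonneg _ _) _))) _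

/-- Both powers have exponent at least one, hence are Lipschitz on bounded intervals, and truncation
confines their arguments to such intervals whatever `u` is. The bound at `x` involves only `[0, x]`,
as the weighted norms below require. -/
lemma exists_radialSlope_lipschitz (n : ℕ) (hm : 1 ≤ m) (hs : 1 ≤ s) (hΛ : 0 ≤ Λ) (hT : 0 ≤ T)
    (hK : Continuous K) (hKpos : ∀ r, 0 < K r) (hKmono : Monotone K) :
    ∃ L : ℝ, 0 < L ∧ ∀ u₁ u₂ : ℝ → ℝ, Continuous u₁ → Continuous u₂ → ∀ x ∈ Icc 0 T, ∀ C : ℝ,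
      (∀ t ∈ Icc 0 x, |u₁ t - u₂ t| ≤ C) →
      |radialSlope n m s Λ K u₁ x - radialSlope n m s Λ K u₂ x| ≤ L * C := by
  set b := K T * Λ ^ s with hb
  have hb0 : 0 ≤ b := mul_nonneg (hKpos T).le (Real.rpow_nonneg hΛ _)
  set L₁ := K T * (s * Λ ^ (s - 1)) with hL₁
  have hL₁0 : 0 ≤ L₁ := mul_nonneg (hKpos T).le (mul_nonneg (by linarith) (Real.rpow_nonneg hΛ _))
  set L₂ := m * (T * b) ^ (m - 1) with hL₂
  have hL₂0 : 0 ≤ L₂ := mul_nonneg (by linarith) (Real.rpow_nonneg (by positivity) _)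
  -- The `+ 1` keeps the constant positive when `T` or `Λ` vanishes.
  refine ⟨L₂ * (T * L₁) + 1, by positivity, fun u₁ u₂ h₁ h₂ x hx C hC => ?_⟩
  have hC0 : 0 ≤ C := (abs_nonneg _).trans (hC 0 ⟨le_rfl, hx.1⟩)
  have key : ∀ u : ℝ → ℝ, Continuous u →
      x * ballAvg n (fun t => K t * trunc Λ (u t) ^ s) x ∈ Icc 0 (T * b) := by
    intro u hu
    refine ⟨mul_nonneg hx.1 (ballAvg_nonneg n hx.1 fun t _ =>
      mul_nonneg (hKpos t).le (Real.rpow_nonneg (trunc_nonneg _ _) _)), ?_⟩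
    refine mul_le_mul hx.2 (ballAvg_le n (continuous_source hs hK hu) hx.1 fun t ht => ?_)
      (ballAvg_nonneg n hx.1 fun t _ =>
      mul_nonneg (hKpos t).le (Real.rpow_nonneg (trunc_nonneg _ _) _)) hT
    rw [abs_of_nonneg (mul_nonneg (hKpos t).le (Real.rpow_nonneg (trunc_nonneg _ _) _))]
    exact mul_le_mul (hKmono (ht.2.trans hx.2))
      (Real.rpow_le_rpow (trunc_nonneg _ _) (trunc_le hΛ _) (by linarith))
      (Real.rpow_nonneg (trunc_nonneg _ _) _) (hKpos T).le
  have h3 : |ballAvg n (fun t => K t * trunc Λ (u₁ t) ^ s) x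
      - ballAvg n (fun t => K t * trunc Λ (u₂ t) ^ s) x| ≤ L₁ * C := by
    refine abs_ballAvg_sub_le n (continuous_source hs hK h₁) (continuous_source hs hK h₂) hx.1
      fun t ht => ?_
    rw [← mul_sub, abs_mul, abs_of_pos (hKpos t), hL₁, mul_assoc]
    refine mul_le_mul (hKmono (ht.2.trans hx.2)) ?_ (abs_nonneg _) (hKpos T).le
    refine (abs_rpow_sub_rpow_le hs ⟨trunc_nonneg _ _, trunc_le hΛ _⟩
      ⟨trunc_nonneg _ _, trunc_le hΛ _⟩).trans ?_
    exact mul_le_mul_of_nonneg_left ((abs_trunc_sub_le _ _ _).trans (hC t ht))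
      (mul_nonneg (by linarith) (Real.rpow_nonneg hΛ _))
  refine (abs_rpow_sub_rpow_le hm (key u₁ h₁) (key u₂ h₂)).trans ?_
  rw [← mul_sub, abs_mul, abs_of_nonneg hx.1, ← hL₂]
  calc _ ≤ L₂ * (T * (L₁ * C)) :=
        mul_le_mul_of_nonneg_left (mul_le_mul hx.2 h3 (abs_nonneg _) hT) hL₂0
    _ ≤ _ := by nlinarith

/-- Integration gains a factor `1 / l` against the weight `exp (l x)`. With `l = 2 L` it turns a
Lipschitz constant `L` into `1 / 2`. -/
lemma abs_integral_sub_le_exp {f g : ℝ → ℝ} (hf : Continuous f) (hg : Continuous g) {C l r : ℝ}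
    (hC : 0 ≤ C) (hl : 0 < l) (hr : 0 ≤ r)
    (h : ∀ x ∈ Icc 0 r, |f x - g x| ≤ C * Real.exp (l * x)) :
    |(∫ x in (0 : ℝ)..r, f x) - ∫ x in (0 : ℝ)..r, g x| ≤ C / l * Real.exp (l * r) := by
  rw [← intervalIntegral.integral_sub (hf.intervalIntegrable _ _) (hg.intervalIntegrable _ _)]
  have h1 : |∫ x in (0 : ℝ)..r, (f x - g x)| ≤ ∫ x in (0 : ℝ)..r, C * Real.exp (l * x) := by
    refine intervalIntegral.norm_integral_le_of_norm_le (f := fun x => f x - g x) hr ?_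
      (Continuous.intervalIntegrable (by fun_prop) _ _)
    exact Eventually.of_forall fun x hx => h x ⟨hx.1.le, hx.2⟩
  have h2 : ∫ x in (0 : ℝ)..r, C * Real.exp (l * x) = C / l * (Real.exp (l * r) - 1) := by
    have : ∀ x ∈ uIcc 0 r,
        HasDerivAt (fun x => C / l * Real.exp (l * x)) (C * Real.exp (l * x)) x := by
      intro x _
      refine ((((hasDerivAt_id x).const_mul l).exp).const_mul (C / l)).congr_deriv ?_
      simp only [id]
      field_simp
    rw [intervalIntegral.integral_eq_sub_of_hasDerivAt this
      (Continuous.intervalIntegrable (by fun_prop) _ _)]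
    simp; ring
  rw [h2] at h1
  have : 0 ≤ C / l := by positivity
  nlinarith

/-- Two solutions of the truncated Volterra equation depend Lipschitz continuously on the
initial value. -/
lemma exists_volterra_dependence (n : ℕ) (hm : 1 ≤ m) (hs : 1 ≤ s) (hΛ : 0 ≤ Λ) (hT : 0 ≤ T)
    (hK : Continuous K) (hKpos : ∀ r, 0 < K r) (hKmono : Monotone K) :
    ∃ L : ℝ, 0 < L ∧ ∀ (a₁ a₂ : ℝ) (u₁ u₂ : ℝ → ℝ), Continuous u₁ → Continuous u₂ →
      (∀ r ∈ Icc 0 T, u₁ r = a₁ - ∫ x in (0 : ℝ)..r, radialSlope n m s Λ K u₁ x) →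
      (∀ r ∈ Icc 0 T, u₂ r = a₂ - ∫ x in (0 : ℝ)..r, radialSlope n m s Λ K u₂ x) →
      ∀ r ∈ Icc 0 T, |u₁ r - u₂ r| ≤ L * |a₁ - a₂| := by
  obtain ⟨L, hL, h⟩ := exists_radialSlope_lipschitz (K := K) n hm hs hΛ hT hK hKpos hKmono
  refine ⟨2 * Real.exp (2 * L * T), by positivity, fun a₁ a₂ u₁ u₂ c₁ c₂ e₁ e₂ r hr => ?_⟩
  have hcont : Continuous fun t => Real.exp (-(2 * L * t)) * |u₁ t - u₂ t| := by fun_prop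
  obtain ⟨t₀, ht₀, hmax⟩ := (isCompact_Icc (a := (0 : ℝ)) (b := T)).exists_isMaxOn
    ⟨0, le_rfl, hT⟩ hcont.continuousOn
  set N := Real.exp (-(2 * L * t₀)) * |u₁ t₀ - u₂ t₀| with hN
  have hN0 : 0 ≤ N := by positivity
  have hb : ∀ t ∈ Icc 0 T, |u₁ t - u₂ t| ≤ N * Real.exp (2 * L * t) := by
    intro t ht
    have : Real.exp (-(2 * L * t)) * |u₁ t - u₂ t| ≤ N := hmax ht
    rw [Real.exp_neg, inv_mul_le_iff₀ (Real.exp_pos _)] at this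
    linarith
  -- At the point where the weighted difference is maximal the equation gives `N ≤ |a₁ - a₂| + N /
  -- 2`, and `N / 2` is absorbed on the left.
  have hI : |u₁ t₀ - u₂ t₀| ≤ |a₁ - a₂| + N / 2 * Real.exp (2 * L * t₀) := by
    rw [e₁ t₀ ht₀, e₂ t₀ ht₀]
    have := abs_integral_sub_le_exp (continuous_radialSlope (n := n) (Λ := Λ) hm hs hK c₁)
      (continuous_radialSlope (n := n) (Λ := Λ) hm hs hK c₂) (C := L * N) (l := 2 * L) (r := t₀)
      (by positivity) (by positivity) ht₀.1 ?_
    · have e : L * N / (2 * L) = N / 2 := by field_simp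
      rw [e] at this
      calc _ = |(a₁ - a₂) - ((∫ x in (0 : ℝ)..t₀, radialSlope n m s Λ K u₁ x)
            - ∫ x in (0 : ℝ)..t₀, radialSlope n m s Λ K u₂ x)| := by congr 1; ring
        _ ≤ _ := (abs_sub _ _).trans (by gcongr)
    · intro x hx
      rw [mul_assoc]
      refine h u₁ u₂ c₁ c₂ x ⟨hx.1, hx.2.trans ht₀.2⟩ _ fun t ht => ?_
      refine (hb t ⟨ht.1, ht.2.trans (hx.2.trans ht₀.2)⟩).trans ?_
      have : 2 * L * t ≤ 2 * L * x := by have := ht.2; gcongr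
      gcongr
  have hN2 : N ≤ 2 * |a₁ - a₂| := by
    have h1 : N ≤ Real.exp (-(2 * L * t₀)) * (|a₁ - a₂| + N / 2 * Real.exp (2 * L * t₀)) := by
      rw [hN]; gcongr
    have h2 : Real.exp (-(2 * L * t₀)) * Real.exp (2 * L * t₀) = 1 := by
      rw [← Real.exp_add]; simp
    have h3 : Real.exp (-(2 * L * t₀)) ≤ 1 := by
      rw [Real.exp_le_one_iff]; have := ht₀.1; have : 0 ≤ 2 * L * t₀ := by positivity
      linarith
    have h4 : Real.exp (-(2 * L * t₀)) * |a₁ - a₂| ≤ |a₁ - a₂| :=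
      mul_le_of_le_one_left (abs_nonneg _) h3
    have h5 : Real.exp (-(2 * L * t₀)) * (|a₁ - a₂| + N / 2 * Real.exp (2 * L * t₀))
      = Real.exp (-(2 * L * t₀)) * |a₁ - a₂| + N / 2 := by linear_combination (N / 2) * h2
    linarith
  have h6 : Real.exp (2 * L * r) ≤ Real.exp (2 * L * T) := by
    have : 2 * L * r ≤ 2 * L * T := by have := hr.2; gcongr
    gcongr
  calc |u₁ r - u₂ r| ≤ N * Real.exp (2 * L * r) := hb r hr
    _ ≤ (2 * |a₁ - a₂|) * Real.exp (2 * L * T) := by gcongr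
    _ = _ := by ring

/-- Solvability of the truncated Volterra equation on a bounded interval. -/
lemma exists_volterra_solution_Icc (n : ℕ) (a : ℝ) (hm : 1 ≤ m) (hs : 1 ≤ s) (hΛ : 0 ≤ Λ)
    (hT : 0 ≤ T) (hK : Continuous K) (hKpos : ∀ r, 0 < K r) (hKmono : Monotone K) :
    ∃ u : ℝ → ℝ, Continuous u ∧
      ∀ r ∈ Icc 0 T, u r = a - ∫ x in (0 : ℝ)..r, radialSlope n m s Λ K u x := by
  obtain ⟨L, hL, h⟩ := exists_radialSlope_lipschitz (K := K) n hm hs hΛ hT hK hKpos hKmono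
  -- The unknown is `y = exp (-2 L t) u`: conjugating by the weight makes the integral operator a
  -- contraction in the ordinary sup norm, without a smallness condition on `T`.
  let X (y : C(Icc (0 : ℝ) T, ℝ)) (t : ℝ) : ℝ := Real.exp (2 * L * t) * IccExtend hT y t
  have hX : ∀ y, Continuous (X y) := fun y =>
    (by fun_prop : Continuous fun t => Real.exp (2 * L * t)).mul (y.continuous.Icc_extend' )
  have hS : ∀ y, Continuous (radialSlope n m s Λ K (X y)) := fun y =>
    continuous_radialSlope hm hs hK (hX y)
  have hI : ∀ y, Continuous fun r => ∫ x in (0 : ℝ)..r, radialSlope n m s Λ K (X y) x := fun y =>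
    intervalIntegral.continuous_primitive (fun _ _ => (hS y).intervalIntegrable _ _) 0
  let S (y : C(Icc (0 : ℝ) T, ℝ)) : C(Icc (0 : ℝ) T, ℝ) :=
    ⟨fun r => Real.exp (-(2 * L * r)) *
      (a - ∫ x in (0 : ℝ)..r, radialSlope n m s Λ K (X y) x), by
        have := hI y
        have h2 : Continuous fun r : ℝ => Real.exp (-(2 * L * r)) *
          (a - ∫ x in (0 : ℝ)..r, radialSlope n m s Λ K (X y) x) := by fun_prop
        exact h2.comp continuous_subtype_val⟩
  have hcontr : ContractingWith (1 / 2) S := by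
    refine ⟨by rw [← NNReal.coe_lt_coe]; norm_num, LipschitzWith.of_dist_le_mul fun y z => ?_⟩
    rw [ContinuousMap.dist_le (by positivity)]
    intro r
    have := abs_integral_sub_le_exp (hS y) (hS z) (C := L * dist y z) (l := 2 * L) (r := r)
      (by positivity) (by positivity) r.2.1 ?_
    · have e : L * dist y z / (2 * L) = dist y z / 2 := by field_simp
      rw [e] at this
      have h2 : Real.exp (-(2 * L * r)) * Real.exp (2 * L * r) = 1 := by
        rw [← Real.exp_add]; simp
      have h3 : dist (S y r) (S z r) = Real.exp (-(2 * L * r)) *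
          |(∫ x in (0 : ℝ)..r, radialSlope n m s Λ K (X y) x)
            - ∫ x in (0 : ℝ)..r, radialSlope n m s Λ K (X z) x| := by
        rw [Real.dist_eq]
        simp only [S, ContinuousMap.coe_mk]
        rw [← mul_sub, abs_mul, abs_of_pos (Real.exp_pos _), ← abs_neg]
        congr 2; ring
      rw [h3]
      calc _ ≤ Real.exp (-(2 * L * r)) * (dist y z / 2 * Real.exp (2 * L * r)) := by gcongr
        _ = dist y z / 2 := by linear_combination (dist y z / 2) * h2
        _ = _ := by push_cast; ring
    · intro x hx
      rw [mul_assoc]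
      refine h _ _ (hX y) (hX z) x ⟨hx.1, hx.2.trans r.2.2⟩ _ fun t ht => ?_
      simp only [X]
      rw [← mul_sub, abs_mul, abs_of_pos (Real.exp_pos _), mul_comm]
      have h4 : |IccExtend hT (⇑y) t - IccExtend hT (⇑z) t| ≤ dist y z :=
        ContinuousMap.dist_apply_le_dist (f := y) (g := z) (projIcc 0 T hT t)
      have : 2 * L * t ≤ 2 * L * x := by have := ht.2; gcongr
      gcongr
  set y := ContractingWith.fixedPoint S hcontr
  have hy : S y = y := hcontr.fixedPoint_isFixedPt
  refine ⟨X y, hX y, fun r hr => ?_⟩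
  have h1 : y ⟨r, hr⟩ = Real.exp (-(2 * L * r)) *
      (a - ∫ x in (0 : ℝ)..r, radialSlope n m s Λ K (X y) x) := by
    conv_lhs => rw [← hy]
    rfl
  have h2 : Real.exp (2 * L * r) * Real.exp (-(2 * L * r)) = 1 := by
    rw [← Real.exp_add]; simp
  calc X y r = Real.exp (2 * L * r) * y ⟨r, hr⟩ := by
        simp only [X]; rw [IccExtend_of_mem hT _ hr]
    _ = _ := by rw [h1, ← mul_assoc, h2, one_mul]

lemma radialSlope_congr {u₁ u₂ : ℝ → ℝ} {Λ' x : ℝ} (hx : 0 ≤ x)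
    (h : ∀ t ∈ Icc 0 x, trunc Λ (u₁ t) = trunc Λ' (u₂ t)) :
    radialSlope n m s Λ K u₁ x = radialSlope n m s Λ' K u₂ x := by
  unfold radialSlope
  rw [ballAvg_congr n hx fun t ht => by rw [h t ht]]

/-- Solvability of the truncated Volterra equation on the half line. -/
lemma exists_volterra_solution (n : ℕ) (a : ℝ) (hm : 1 ≤ m) (hs : 1 ≤ s) (hΛ : 0 ≤ Λ)
    (hK : Continuous K) (hKpos : ∀ r, 0 < K r) (hKmono : Monotone K) :
    ∃ u : ℝ → ℝ, Continuous u ∧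
      ∀ r, 0 ≤ r → u r = a - ∫ x in (0 : ℝ)..r, radialSlope n m s Λ K u x := by
  have hex : ∀ T : ℝ, ∃ u : ℝ → ℝ, Continuous u ∧
      ∀ r ∈ Icc 0 T, u r = a - ∫ x in (0 : ℝ)..r, radialSlope n m s Λ K u x := by
    intro T
    obtain ⟨u, hu, h⟩ := exists_volterra_solution_Icc n a hm hs hΛ (le_max_right T 0)
      hK hKpos hKmono
    exact ⟨u, hu, fun r hr => h r ⟨hr.1, hr.2.trans (le_max_left _ _)⟩⟩
  choose w hwc hw using hex
  have huniq : ∀ T T' r, 0 ≤ r → r ≤ T → r ≤ T' → w T r = w T' r := by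
    intro T T' r h0 hT hT'
    obtain ⟨L, -, h⟩ := exists_volterra_dependence (K := K) n hm hs hΛ h0 hK hKpos hKmono
    have := h a a (w T) (w T') (hwc T) (hwc T') (fun x hx => hw T x ⟨hx.1, hx.2.trans hT⟩)
      (fun x hx => hw T' x ⟨hx.1, hx.2.trans hT'⟩) r ⟨h0, le_rfl⟩
    rw [sub_self, abs_zero, mul_zero] at this
    exact sub_eq_zero.1 (abs_nonpos_iff.1 this)
  have heq : ∀ T r, 0 ≤ r → r ≤ T → w (max r 0 + 1) (max r 0) = w T r := by
    intro T r h0 hT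
    rw [max_eq_left h0]
    exact huniq _ _ r h0 (by linarith) hT
  -- The margin `1` lets one fixed local solution represent the function near each point, which
  -- gives continuity; `max r 0` extends it by a constant to the left.
  refine ⟨fun r => w (max r 0 + 1) (max r 0), ?_, fun r hr => ?_⟩
  · rw [continuous_iff_continuousAt]
    intro r₀
    have hc : ContinuousAt (fun r => w (max r₀ 0 + 1) (max r 0)) r₀ :=
      ((hwc _).comp (continuous_id.max continuous_const)).continuousAt
    refine hc.congr ?_
    filter_upwards [Iio_mem_nhds (show r₀ < max r₀ 0 + 1 by linarith [le_max_left r₀ 0])] with r hr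
    refine huniq _ _ _ (le_max_right _ _) (max_le (le_of_lt hr) ?_) (by linarith)
    linarith [le_max_right r₀ 0]
  · simp only
    rw [heq r r hr le_rfl, hw r r ⟨hr, le_rfl⟩]
    congr 1
    refine intervalIntegral.integral_congr fun x hx => ?_
    rw [uIcc_of_le hr] at hx
    exact radialSlope_congr hx.1 fun t ht => by rw [heq r t ht.1 (ht.2.trans hx.2)]

end Volterra

/-! ### The shooting problem -/

/-- Standing assumptions for the shooting problem: `m = 1 / (p - 1)`, `q` is the critical exponent
and `γ = p / (n - p)`. -/
structure ShootingData (n : ℕ) (m q γ : ℝ) (K : ℝ → ℝ) : Prop where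
  n_pos : 0 < n
  one_le_m : 1 ≤ m
  two_le_q : 2 ≤ q
  γ_pos : 0 < γ
  q_eq : q = n * γ
  q_mul : q * m = (1 + m) * (1 + γ)
  cont : Continuous K
  pos : ∀ r, 0 < K r
  mono : Monotone K
  diff : ∀ r, 0 < r → DifferentiableAt ℝ K r

/-- The average `r⁻ⁿ ∫₀ʳ tⁿ⁻¹ K(t) u₊(t)^(q-1) dt`. -/
def fluxAvg (n : ℕ) (q : ℝ) (K u : ℝ → ℝ) : ℝ → ℝ :=
  ballAvg n fun t => K t * max (u t) 0 ^ (q - 1)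

/-- `u` solves the radial initial value problem on `[0, ∞)` with `u 0 = a`, in integrated form. -/
structure IsShot (n : ℕ) (m q : ℝ) (K : ℝ → ℝ) (a : ℝ) (u : ℝ → ℝ) : Prop where
  cont : Continuous u
  pos : 0 < a
  eq : ∀ r, 0 ≤ r → u r = a - ∫ x in (0 : ℝ)..r, (x * fluxAvg n q K u x) ^ m

section Shot

variable {n : ℕ} {m q γ a : ℝ} {K u : ℝ → ℝ}

lemma ShootingData.continuous_source (h : ShootingData n m q γ K) (hu : Continuous u) :
    Continuous fun t => K t * max (u t) 0 ^ (q - 1) :=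
  h.cont.mul ((hu.max continuous_const).rpow_const fun _ => Or.inr (by linarith [h.two_le_q]))

lemma ShootingData.continuous_fluxAvg (h : ShootingData n m q γ K) (hu : Continuous u) :
    Continuous (fluxAvg n q K u) := continuous_ballAvg n (h.continuous_source hu)

lemma ShootingData.continuous_slope (h : ShootingData n m q γ K) (hu : Continuous u) :
    Continuous fun x => (x * fluxAvg n q K u x) ^ m :=
  (continuous_id.mul (h.continuous_fluxAvg hu)).rpow_const
    fun _ => Or.inr (by linarith [h.one_le_m])

lemma ShootingData.fluxAvg_nonneg (h : ShootingData n m q γ K) (u : ℝ → ℝ) {r : ℝ} (hr : 0 ≤ r) :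
    0 ≤ fluxAvg n q K u r :=
  ballAvg_nonneg n hr fun t _ => mul_nonneg (h.pos t).le (Real.rpow_nonneg (le_max_right _ _) _)

lemma ShootingData.slope_nonneg (h : ShootingData n m q γ K) (u : ℝ → ℝ) {r : ℝ} (hr : 0 ≤ r) :
    0 ≤ (r * fluxAvg n q K u r) ^ m :=
  Real.rpow_nonneg (mul_nonneg hr (h.fluxAvg_nonneg u hr)) _

lemma radialSlope_eq_of_le {Λ x : ℝ} (hx : 0 ≤ x) (hu : ∀ t ∈ Icc 0 x, u t ≤ Λ) :
    radialSlope n m (q - 1) Λ K u x = (x * fluxAvg n q K u x) ^ m := by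
  unfold radialSlope fluxAvg
  rw [ballAvg_congr n hx fun t ht => by rw [trunc_of_le (hu t ht)]]

/-- A solution of the integrated equation on `[0, T]` stays below its initial value. -/
lemma ShootingData.le_init (h : ShootingData n m q γ K) {T : ℝ}
    (he : ∀ r ∈ Icc 0 T, u r = a - ∫ x in (0 : ℝ)..r, (x * fluxAvg n q K u x) ^ m)
    {r : ℝ} (hr : r ∈ Icc 0 T) : u r ≤ a := by
  rw [he r hr]
  have := intervalIntegral.integral_nonneg (f := fun x => (x * fluxAvg n q K u x) ^ m)
    (μ := MeasureTheory.volume) hr.1 fun x hx => h.slope_nonneg u hx.1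
  linarith

/-- Truncate at level `a`. The slope is nonnegative, so the solution never exceeds `a`, the upper
truncation never acts, and only the positive part remains. -/
lemma ShootingData.exists_isShot (h : ShootingData n m q γ K) (ha : 0 < a) :
    ∃ u, IsShot n m q K a u := by
  obtain ⟨u, hc, hu⟩ := exists_volterra_solution (s := q - 1) n a h.one_le_m
    (by linarith [h.two_le_q]) ha.le h.cont h.pos h.mono
  have hle : ∀ r, 0 ≤ r → u r ≤ a := by
    intro r hr
    rw [hu r hr]
    have := intervalIntegral.integral_nonneg (μ := MeasureTheory.volume)
      (f := radialSlope n m (q - 1) a K u) hr fun x hx => radialSlope_nonneg h.pos u hx.1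
    linarith
  refine ⟨u, hc, ha, fun r hr => ?_⟩
  rw [hu r hr]
  congr 1
  refine intervalIntegral.integral_congr fun x hx => ?_
  rw [uIcc_of_le hr] at hx
  exact radialSlope_eq_of_le hx.1 fun t ht => hle t ht.1

/-- Lipschitz dependence on the initial value. -/
lemma ShootingData.exists_dependence (h : ShootingData n m q γ K) {Λ T : ℝ} (hΛ : 0 ≤ Λ)
    (hT : 0 ≤ T) : ∃ L : ℝ, 0 < L ∧ ∀ (a₁ a₂ : ℝ) (u₁ u₂ : ℝ → ℝ), a₁ ≤ Λ → a₂ ≤ Λ →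
      Continuous u₁ → Continuous u₂ →
      (∀ r ∈ Icc 0 T, u₁ r = a₁ - ∫ x in (0 : ℝ)..r, (x * fluxAvg n q K u₁ x) ^ m) →
      (∀ r ∈ Icc 0 T, u₂ r = a₂ - ∫ x in (0 : ℝ)..r, (x * fluxAvg n q K u₂ x) ^ m) →
      ∀ r ∈ Icc 0 T, |u₁ r - u₂ r| ≤ L * |a₁ - a₂| := by
  obtain ⟨L, hL, hdep⟩ := exists_volterra_dependence (s := q - 1) n h.one_le_m
    (by linarith [h.two_le_q]) hΛ hT h.cont h.pos h.mono
  have key : ∀ (a : ℝ) (u : ℝ → ℝ), a ≤ Λ →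
      (∀ r ∈ Icc 0 T, u r = a - ∫ x in (0 : ℝ)..r, (x * fluxAvg n q K u x) ^ m) →
      ∀ r ∈ Icc 0 T, u r = a - ∫ x in (0 : ℝ)..r, radialSlope n m (q - 1) Λ K u x := by
    intro a u ha he r hr
    rw [he r hr]
    congr 1
    refine intervalIntegral.integral_congr fun x hx => ?_
    rw [uIcc_of_le hr.1] at hx
    exact (radialSlope_eq_of_le hx.1 fun t ht =>
      (h.le_init he ⟨ht.1, ht.2.trans (hx.2.trans hr.2)⟩).trans ha).symm
  exact ⟨L, hL, fun a₁ a₂ u₁ u₂ h₁ h₂ c₁ c₂ e₁ e₂ =>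
    hdep a₁ a₂ u₁ u₂ c₁ c₂ (key a₁ u₁ h₁ e₁) (key a₂ u₂ h₂ e₂)⟩

namespace IsShot

lemma apply_zero (hu : IsShot n m q K a u) : u 0 = a := by simpa using hu.eq 0 le_rfl

lemma le_init (hu : IsShot n m q K a u) (h : ShootingData n m q γ K) {r : ℝ} (hr : 0 ≤ r) :
    u r ≤ a := h.le_init (fun r hr => hu.eq r hr.1) ⟨hr, le_rfl⟩

lemma fluxAvg_zero (hu : IsShot n m q K a u) (h : ShootingData n m q γ K) :
    fluxAvg n q K u 0 = K 0 * a ^ (q - 1) / n := by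
  rw [fluxAvg, ballAvg_zero h.n_pos, hu.apply_zero, max_eq_left hu.pos.le]

lemma hasDerivAt (hu : IsShot n m q K a u) (h : ShootingData n m q γ K) {r : ℝ} (hr : 0 < r) :
    HasDerivAt u (-(r * fluxAvg n q K u r) ^ m) r := by
  have hc := h.continuous_slope hu.cont
  have h1 := (intervalIntegral.integral_hasDerivAt_right (hc.intervalIntegrable 0 r)
    (hc.stronglyMeasurableAtFilter _ _) hc.continuousAt).const_sub a
  refine h1.congr_of_eventuallyEq ?_
  filter_upwards [Ioi_mem_nhds hr] with x hx using hu.eq x (le_of_lt hx)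

lemma hasDerivAt_fluxAvg (hu : IsShot n m q K a u) (h : ShootingData n m q γ K) {r : ℝ}
    (hr : 0 < r) : HasDerivAt (fluxAvg n q K u)
      ((K r * max (u r) 0 ^ (q - 1) - n * fluxAvg n q K u r) / r) r :=
  hasDerivAt_ballAvg h.n_pos (h.continuous_source hu.cont) hr.ne'

lemma fluxAvg_le (hu : IsShot n m q K a u) (h : ShootingData n m q γ K) {r : ℝ} (hr : 0 ≤ r) :
    fluxAvg n q K u r ≤ K r * a ^ (q - 1) := by
  refine ballAvg_le n (h.continuous_source hu.cont) hr fun t ht => ?_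
  rw [abs_of_nonneg (mul_nonneg (h.pos t).le (Real.rpow_nonneg (le_max_right _ _) _))]
  exact mul_le_mul (h.mono ht.2) (Real.rpow_le_rpow (le_max_right _ _)
    (max_le (hu.le_init h ht.1) hu.pos.le) (by linarith [h.two_le_q]))
    (Real.rpow_nonneg (le_max_right _ _) _) (h.pos r).le

lemma init_sub_le (hu : IsShot n m q K a u) (h : ShootingData n m q γ K) {r : ℝ} (hr : 0 ≤ r) :
    a - r * (r * (K r * a ^ (q - 1))) ^ m ≤ u r := by
  rw [hu.eq r hr]
  have h1 : ∫ x in (0 : ℝ)..r, (x * fluxAvg n q K u x) ^ m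
      ≤ ∫ x in (0 : ℝ)..r, (r * (K r * a ^ (q - 1))) ^ m := by
    refine intervalIntegral.integral_mono_on hr
      ((h.continuous_slope hu.cont).intervalIntegrable _ _) (by simp) fun x hx => ?_
    refine Real.rpow_le_rpow (mul_nonneg hx.1 (h.fluxAvg_nonneg u hx.1)) ?_
      (by linarith [h.one_le_m])
    refine mul_le_mul hx.2 ((hu.fluxAvg_le h hx.1).trans ?_) (h.fluxAvg_nonneg u hx.1) hr
    exact mul_le_mul_of_nonneg_right (h.mono hx.2) (Real.rpow_nonneg hu.pos.le _)
  simp at h1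
  linarith

end IsShot

/-! ### The Pohozaev functional -/

/-- The Pohozaev density of a radial function. -/
def pohozaevDensity (n : ℕ) (m q γ : ℝ) (K u : ℝ → ℝ) (r : ℝ) : ℝ :=
  (r * fluxAvg n q K u r) ^ (1 + m) / (1 + m) + K r * u r ^ q / q - u r * fluxAvg n q K u r / γ

/-- The Pohozaev functional of a radial function. -/
def pohozaev (n : ℕ) (m q γ : ℝ) (K u : ℝ → ℝ) (r : ℝ) : ℝ :=
  r ^ n * pohozaevDensity n m q γ K u r

lemma ShootingData.continuous_pohozaev (h : ShootingData n m q γ K) (hu : Continuous u) :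
    Continuous (pohozaev n m q γ K u) := by
  have hg := h.continuous_fluxAvg hu
  have h1 : Continuous fun r => (r * fluxAvg n q K u r) ^ (1 + m) :=
    (continuous_id.mul hg).rpow_const fun _ => Or.inr (by linarith [h.one_le_m])
  have h2 : Continuous fun r => u r ^ q := hu.rpow_const fun _ => Or.inr (by linarith [h.two_le_q])
  have hK := h.cont
  unfold pohozaev pohozaevDensity
  fun_prop

lemma ShootingData.deriv_nonneg (h : ShootingData n m q γ K) (r : ℝ) : 0 ≤ deriv K r :=
  h.mono.deriv_nonneg

/-- The algebra behind the derivative of the Pohozaev functional, with `G` for the flux average, `D`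
for `(r G)^m = -u'`, `w` for `u`, `U` for `u^(q-1)`, and `k`, `k'` for `K`, `K'`. The two relations
expressing criticality cancel every term without `k'`. -/
lemma pohozaev_deriv_identity {r G D U w k k' : ℝ} (hn : 0 < n) (hr : r ≠ 0) (hm : 1 + m ≠ 0)
    (hq : q ≠ 0) (hγ : γ ≠ 0) (hqe : q = n * γ) (hqm : q * m = (1 + m) * (1 + γ)) :
    n * r ^ (n - 1) * (r * G * D / (1 + m) + k * (w * U) / q - w * G / γ)
      + r ^ n * ((G + r * ((k * U - n * G) / r)) * (1 + m) * D / (1 + m)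
        + (k' * (w * U) + k * (-D * q * U)) / q - (-D * G + w * ((k * U - n * G) / r)) / γ)
      = r ^ n * (k' * (w * U) / q) := by
  obtain ⟨j, rfl⟩ : ∃ j, n = j + 1 := ⟨n - 1, by omega⟩
  simp only [Nat.add_sub_cancel]
  generalize ((j + 1 : ℕ) : ℝ) = N at *
  have r1 : N / q = 1 / γ := by field_simp; exact hqe.symm
  have r2 : 1 / γ - N + 1 + N / (1 + m) = 0 := by
    rw [hqe] at hqm
    field_simp
    linear_combination -hqm
  have a1 : r * ((k * U - N * G) / r) = k * U - N * G := by field_simp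
  have a2 : (G + (k * U - N * G)) * (1 + m) * D / (1 + m) = (G + (k * U - N * G)) * D := by
    field_simp
  have a3 : (k' * (w * U) + k * (-D * q * U)) / q = k' * (w * U) / q - k * D * U := by
    field_simp; ring
  rw [a1, a2, a3, pow_succ]
  linear_combination r ^ j * r * G * D * r2 + r ^ j * k * w * U * r1 - r ^ j * w / γ * a1

namespace IsShot

lemma hasDerivAt_pohozaev (hu : IsShot n m q K a u) (h : ShootingData n m q γ K) {r : ℝ}
    (hr : 0 < r) (hur : 0 < u r) :
    HasDerivAt (pohozaev n m q γ K u) (r ^ n * (deriv K r * u r ^ q / q)) r := by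
  have hm := h.one_le_m
  have hq := h.two_le_q
  have hγ := h.γ_pos
  have hq' : q ≠ 0 := by linarith
  have hm' : (1 + m) ≠ 0 := by linarith
  have hg := hu.hasDerivAt_fluxAvg h hr
  have hd := hu.hasDerivAt h hr
  have h1 := (((hasDerivAt_id r).mul hg).rpow_const (p := 1 + m) (Or.inr (by linarith))).div_const
    (1 + m)
  have h2 := ((h.diff r hr).hasDerivAt.mul
    (hd.rpow_const (p := q) (Or.inl hur.ne'))).div_const q
  have h3 := (hd.mul hg).div_const γ
  have h4 := (hasDerivAt_pow n r).mul ((h1.add h2).sub h3)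
  refine HasDerivAt.congr_deriv (f := pohozaev n m q γ K u) h4 ?_
  simp only [Pi.mul_apply, id, Pi.add_apply, Pi.sub_apply, one_mul]
  have e1 : (r * fluxAvg n q K u r) ^ (1 + m) =
      (r * fluxAvg n q K u r) * (r * fluxAvg n q K u r) ^ m := by
    rw [Real.rpow_add_of_nonneg (mul_nonneg hr.le (h.fluxAvg_nonneg u hr.le)) zero_le_one
      (by linarith), Real.rpow_one]
  have e2 : u r ^ q = u r * u r ^ (q - 1) := by
    rw [Real.rpow_sub_one hur.ne']; field_simp
  have e3 : 1 + m - 1 = m := by ring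
  rw [max_eq_left hur.le, e1, e2, e3]
  exact pohozaev_deriv_identity h.n_pos hr.ne' hm' hq' hγ.ne' h.q_eq h.q_mul

lemma pohozaev_monotoneOn (hu : IsShot n m q K a u) (h : ShootingData n m q γ K) {S : ℝ}
    (hpos : ∀ t ∈ Ico 0 S, 0 < u t) : MonotoneOn (pohozaev n m q γ K u) (Icc 0 S) := by
  refine monotoneOn_of_hasDerivWithinAt_nonneg (convex_Icc 0 S)
    (h.continuous_pohozaev hu.cont).continuousOn
    (f' := fun r => r ^ n * (deriv K r * u r ^ q / q)) ?_ ?_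
  · intro x hx
    rw [interior_Icc] at hx
    exact (hu.hasDerivAt_pohozaev h hx.1 (hpos x ⟨hx.1.le, hx.2⟩)).hasDerivWithinAt
  · intro x hx
    rw [interior_Icc] at hx
    have := h.deriv_nonneg x
    have h1 := hpos x ⟨hx.1.le, hx.2⟩
    have := h.two_le_q
    have := hx.1
    positivity

lemma pohozaev_zero (h : ShootingData n m q γ K) : pohozaev n m q γ K u 0 = 0 := by
  simp [pohozaev, h.n_pos.ne']

lemma pohozaev_nonneg (hu : IsShot n m q K a u) (h : ShootingData n m q γ K) {S : ℝ}
    (hpos : ∀ t ∈ Ico 0 S, 0 < u t) {r : ℝ} (hr : r ∈ Icc 0 S) :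
    0 ≤ pohozaev n m q γ K u r := by
  rw [← pohozaev_zero (u := u) h]
  exact hu.pohozaev_monotoneOn h hpos ⟨le_rfl, hr.1.trans hr.2⟩ hr hr.1

/-! ### A priori bounds from the Pohozaev inequality -/

/-- The Pohozaev inequality in integrated form. -/
lemma fluxAvg_ge (hu : IsShot n m q K a u) (h : ShootingData n m q γ K) {S : ℝ}
    (hpos : ∀ t ∈ Ico 0 S, 0 < u t) {r : ℝ} (hr : r ∈ Ico 0 S) :
    K 0 / n * a ^ γ * u r ^ ((1 + γ) / m) ≤ fluxAvg n q K u r := by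
  have hm := h.one_le_m
  have hq := h.two_le_q
  have hγ := h.γ_pos
  have hn := h.n_pos
  set β := (1 + γ) / m with hβ
  have hβq : β = q / (1 + m) := by
    rw [hβ]; field_simp; linear_combination -h.q_mul
  -- The exponent `β = q / (1 + m)` is the one for which the derivative is a positive multiple of
  -- the Pohozaev density. Comparison with `r = 0` then gives the claim.
  have hmono : MonotoneOn (fun r => fluxAvg n q K u r * u r ^ (-β)) (Ico 0 S) := by
    refine monotoneOn_of_hasDerivWithinAt_nonneg (convex_Ico 0 S) ?_
      (f' := fun r => u r ^ (-β - 1) * (q * pohozaevDensity n m q γ K u r / r)) ?_ ?_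
    · refine (h.continuous_fluxAvg hu.cont).continuousOn.mul
        (hu.cont.continuousOn.rpow_const fun x hx => Or.inl (hpos x hx).ne')
    · intro x hx
      rw [interior_Ico] at hx
      have hux := hpos x ⟨hx.1.le, hx.2⟩
      have hx0 := hx.1
      have h1 := (hu.hasDerivAt_fluxAvg h hx.1).mul
        ((hu.hasDerivAt h hx.1).rpow_const (p := -β) (Or.inl hux.ne'))
      refine (h1.congr_deriv ?_).hasDerivWithinAt
      have e1 : (x * fluxAvg n q K u x) ^ (1 + m) =
          (x * fluxAvg n q K u x) * (x * fluxAvg n q K u x) ^ m := by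
        rw [Real.rpow_add_of_nonneg (mul_nonneg hx0.le (h.fluxAvg_nonneg u hx0.le)) zero_le_one
          (by linarith), Real.rpow_one]
      have e2 : u x ^ q = u x * u x ^ (q - 1) := by
        rw [Real.rpow_sub_one hux.ne']; field_simp
      have e3 : u x ^ (-β) = u x * u x ^ (-β - 1) := by
        rw [Real.rpow_sub_one hux.ne']; field_simp
      rw [pohozaevDensity, max_eq_left hux.le, e1, e2, e3, hβq]
      generalize u x ^ (-(q / (1 + m)) - 1) = V
      generalize u x ^ (q - 1) = U
      generalize (x * fluxAvg n q K u x) ^ m = D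
      generalize fluxAvg n q K u x = G
      have r1 : q / γ = n := by rw [h.q_eq]; field_simp
      rw [← r1]
      field_simp
      ring
    · intro x hx
      rw [interior_Ico] at hx
      have hux := hpos x ⟨hx.1.le, hx.2⟩
      have hx0 := hx.1
      have h1 := hu.pohozaev_nonneg h hpos ⟨hx.1.le, hx.2.le⟩
      have h2 : 0 ≤ pohozaevDensity n m q γ K u x :=
        nonneg_of_mul_nonneg_right h1 (pow_pos hx0 n)
      positivity
  have h0 := hmono ⟨le_rfl, hr.1.trans_lt hr.2⟩ hr hr.1
  simp only [hu.fluxAvg_zero h, hu.apply_zero] at h0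
  have hur := hpos r hr
  have ha := hu.pos
  have e1 : a ^ (q - 1) * a ^ (-β) = a ^ γ := by
    rw [← Real.rpow_add ha]
    congr 1
    rw [hβ]; field_simp; linear_combination h.q_mul
  have e2 : u r ^ (-β) * u r ^ β = 1 := by rw [← Real.rpow_add hur]; simp
  calc K 0 / n * a ^ γ * u r ^ β = (K 0 * a ^ (q - 1) / n * a ^ (-β)) * u r ^ β := by
        rw [← e1]; ring
    _ ≤ (fluxAvg n q K u r * u r ^ (-β)) * u r ^ β := by gcongr
    _ = fluxAvg n q K u r := by rw [mul_assoc, e2, mul_one]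

/-- The a priori decay estimate given by the Pohozaev inequality. -/
lemma rpow_le_of_pos (hu : IsShot n m q K a u) (h : ShootingData n m q γ K) {S : ℝ}
    (hpos : ∀ t ∈ Ico 0 S, 0 < u t) {r : ℝ} (hr : r ∈ Ico 0 S) :
    (γ / (1 + m) * (K 0 / n) ^ m) * a ^ (γ * m) * r ^ (1 + m) * u r ^ γ ≤ 1 := by
  have hm := h.one_le_m
  have hq := h.two_le_q
  have hγ := h.γ_pos
  have hn := h.n_pos
  have ha := hu.pos
  have hK := h.pos 0
  set c := (γ / (1 + m) * (K 0 / n) ^ m) * a ^ (γ * m) with hc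
  -- The derivative of `u^(-γ)` is `γ u^(-γ-1) (r G)^m`. Inserting the lower bound for `G`, whose
  -- power of `u` becomes `1 + γ` after raising to `m`, removes `u` and leaves a multiple of `r^m`.
  have hmono : MonotoneOn (fun r => u r ^ (-γ) - c * r ^ (1 + m)) (Ico 0 S) := by
    refine monotoneOn_of_hasDerivWithinAt_nonneg (convex_Ico 0 S) ?_
      (f' := fun r => γ * u r ^ (-γ - 1) * (r * fluxAvg n q K u r) ^ m - c * ((1 + m) * r ^ m)) ?_ ?_
    · refine ContinuousOn.sub (hu.cont.continuousOn.rpow_const fun x hx => Or.inl (hpos x hx).ne')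
        (continuousOn_const.mul (continuousOn_id.rpow_const fun x hx => Or.inr (by linarith)))
    · intro x hx
      rw [interior_Ico] at hx
      have hux := hpos x ⟨hx.1.le, hx.2⟩
      have h1 := ((hu.hasDerivAt h hx.1).rpow_const (p := -γ) (Or.inl hux.ne')).sub
        ((Real.hasDerivAt_rpow_const (p := 1 + m) (Or.inl hx.1.ne')).const_mul c)
      refine (h1.congr_deriv ?_).hasDerivWithinAt
      rw [show 1 + m - 1 = m by ring]
      ring
    · intro x hx
      rw [interior_Ico] at hx
      have hux := hpos x ⟨hx.1.le, hx.2⟩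
      have hx0 := hx.1
      have h1 := hu.fluxAvg_ge h hpos ⟨hx.1.le, hx.2⟩
      have h2 : (x * (K 0 / n * a ^ γ * u x ^ ((1 + γ) / m))) ^ m ≤ (x * fluxAvg n q K u x) ^ m := by
        apply Real.rpow_le_rpow (by positivity) _ (by linarith)
        gcongr
      have h3 : (x * (K 0 / n * a ^ γ * u x ^ ((1 + γ) / m))) ^ m
          = x ^ m * ((K 0 / n) ^ m * a ^ (γ * m) * u x ^ (1 + γ)) := by
        rw [Real.mul_rpow hx0.le (by positivity), Real.mul_rpow (by positivity) (by positivity),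
          Real.mul_rpow (by positivity) (by positivity), ← Real.rpow_mul ha.le,
          ← Real.rpow_mul hux.le, div_mul_cancel₀ _ (by linarith)]
      rw [h3] at h2
      have e2 : u x ^ (-γ - 1) * u x ^ (1 + γ) = 1 := by
        rw [← Real.rpow_add hux]; ring_nf; simp
      have h4 : c * ((1 + m) * x ^ m) = γ * u x ^ (-γ - 1) *
          (x ^ m * ((K 0 / n) ^ m * a ^ (γ * m) * u x ^ (1 + γ))) := by
        rw [hc]
        have : γ / (1 + m) * (1 + m) = γ := div_mul_cancel₀ _ (by linarith)
        linear_combination (K 0 / n) ^ m * a ^ (γ * m) * x ^ m * this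
          - γ * x ^ m * (K 0 / n) ^ m * a ^ (γ * m) * e2
      rw [h4, sub_nonneg]
      gcongr
  have h0 := hmono ⟨le_rfl, hr.1.trans_lt hr.2⟩ hr hr.1
  simp only [hu.apply_zero] at h0
  rw [Real.zero_rpow (by linarith), mul_zero, sub_zero] at h0
  have hur := hpos r hr
  have h1 : 0 < a ^ (-γ) := by positivity
  have e2 : u r ^ (-γ) * u r ^ γ = 1 := by rw [← Real.rpow_add hur]; simp
  calc c * r ^ (1 + m) * u r ^ γ ≤ u r ^ (-γ) * u r ^ γ := by gcongr; linarith
    _ = 1 := e2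

end IsShot

/-! ### The first zero of a shot -/

/-- Rewrites powers of `r G` through the flux `rⁿ G`, which unlike `G` is monotone. -/
lemma mul_rpow_eq_pow_mul_rpow {r g : ℝ} (n : ℕ) (e : ℝ) (hr : 0 < r) (hg : 0 ≤ g) :
    (r * g) ^ e = (r ^ n * g) ^ e * r ^ ((1 - n) * e) := by
  rw [Real.rpow_mul hr.le, ← Real.mul_rpow (by positivity) (by positivity)]
  congr 1
  rw [mul_right_comm, ← Real.rpow_natCast, ← Real.rpow_add hr]
  simp

lemma ShootingData.n_mul_m (h : ShootingData n m q γ K) :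
    (n : ℝ) * m = (1 + m) / γ + (1 + m) := by
  have hγ := h.γ_pos
  have := h.q_mul
  rw [h.q_eq] at this
  field_simp
  linear_combination this

lemma ShootingData.criticalRate_pos (h : ShootingData n m q γ K) : 0 < (1 + m) / γ := by
  have hγ := h.γ_pos
  have := h.one_le_m
  positivity

lemma ShootingData.slope_eq (h : ShootingData n m q γ K) {r g : ℝ} (hr : 0 < r) (hg : 0 ≤ g) :
    (r * g) ^ m = (r ^ n * g) ^ m * r ^ (-((1 + m) / γ) - 1) := by
  rw [mul_rpow_eq_pow_mul_rpow n m hr hg]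
  congr 2
  linear_combination -h.n_mul_m

lemma ShootingData.pow_mul_slope_eq (h : ShootingData n m q γ K) {r g : ℝ} (hr : 0 < r)
    (hg : 0 ≤ g) :
    r ^ n * (r * g) ^ (1 + m) = (r ^ n * g) ^ (1 + m) * r ^ (-((1 + m) / γ)) := by
  rw [mul_rpow_eq_pow_mul_rpow n (1 + m) hr hg, mul_left_comm, ← Real.rpow_natCast,
    ← Real.rpow_add hr]
  congr 2
  linear_combination -h.n_mul_m

lemma ShootingData.monotoneOn_flux (h : ShootingData n m q γ K) (hu : Continuous u) :
    MonotoneOn (fun r => r ^ n * fluxAvg n q K u r) (Ici 0) := by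
  have hd := hasDerivAt_pow_mul_ballAvg h.n_pos (h.continuous_source hu)
  refine monotoneOn_of_hasDerivWithinAt_nonneg (convex_Ici 0)
    (fun x _ => (hd x).continuousAt.continuousWithinAt) (fun x _ => (hd x).hasDerivWithinAt) ?_
  intro x hx
  rw [interior_Ici] at hx
  exact mul_nonneg (pow_nonneg (le_of_lt hx) _)
    (mul_nonneg (h.pos x).le (Real.rpow_nonneg (le_max_right _ _) _))

/-- The `γ`-th root of `IsShot.rpow_le_of_pos`. The constant is uniform in `a` and in the interval
of positivity. -/
lemma ShootingData.exists_decay (h : ShootingData n m q γ K) :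
    ∃ c : ℝ, 0 < c ∧ ∀ (a : ℝ) (u : ℝ → ℝ), IsShot n m q K a u → ∀ S : ℝ,
      (∀ t ∈ Ico 0 S, 0 < u t) → ∀ r ∈ Ioo 0 S, c * a ^ m * r ^ ((1 + m) / γ) * u r ≤ 1 := by
  have hm := h.one_le_m
  have hγ := h.γ_pos
  have hn := h.n_pos
  have hK := h.pos 0
  set c := γ / (1 + m) * (K 0 / n) ^ m with hc
  have hc0 : 0 < c := by positivity
  refine ⟨c ^ (1 / γ), by positivity, fun a u hu S hpos r hr => ?_⟩
  have h1 := hu.rpow_le_of_pos h hpos ⟨hr.1.le, hr.2⟩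
  have hur := hpos r ⟨hr.1.le, hr.2⟩
  have ha := hu.pos
  have hr0 := hr.1
  rw [← hc] at h1
  have h2 : (c ^ (1 / γ) * a ^ m * r ^ ((1 + m) / γ) * u r) ^ γ ≤ 1 := by
    rw [Real.mul_rpow (by positivity) hur.le, Real.mul_rpow (by positivity) (by positivity),
      Real.mul_rpow (by positivity) (by positivity), ← Real.rpow_mul hc0.le, ← Real.rpow_mul ha.le,
      ← Real.rpow_mul hr0.le, div_mul_cancel₀ _ hγ.ne', div_mul_cancel₀ _ hγ.ne', Real.rpow_one,
      mul_comm m γ]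
    exact h1
  by_contra hlt
  exact absurd h2 (not_le.2 (Real.one_lt_rpow (not_le.1 hlt) hγ))

namespace IsShot

/-- Otherwise the functional, nondecreasing from `0`, vanishes on all of `[0, y]`; but its
derivative is positive at a mean value point where `K' > 0`. -/
lemma exists_pohozaev_pos (hu : IsShot n m q K a u) (h : ShootingData n m q γ K)
    {x y : ℝ} (hx : 0 ≤ x) (hxy : x < y) (hK : K x < K y) (hpos : ∀ t ∈ Icc 0 y, 0 < u t) :
    0 < pohozaev n m q γ K u y := by
  have hpos' : ∀ t ∈ Ico 0 y, 0 < u t := fun t ht => hpos t ⟨ht.1, ht.2.le⟩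
  have hmono := hu.pohozaev_monotoneOn h hpos'
  by_contra hneg
  have h0 : ∀ r ∈ Icc 0 y, pohozaev n m q γ K u r = 0 := fun r hr =>
    le_antisymm ((hmono hr ⟨hr.1.trans hr.2, le_rfl⟩ hr.2).trans (not_lt.1 hneg))
      (hu.pohozaev_nonneg h hpos' hr)
  obtain ⟨c, hc, hcK⟩ := exists_deriv_eq_slope K hxy h.cont.continuousOn fun z hz =>
    (h.diff z (hx.trans_lt hz.1)).differentiableWithinAt
  have hc0 : 0 < c := hx.trans_lt hc.1
  have hKc : 0 < deriv K c := by
    rw [hcK]; exact div_pos (by linarith) (by linarith)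
  have hd := hu.hasDerivAt_pohozaev h hc0 (hpos c ⟨hc0.le, hc.2.le⟩)
  have hd0 : HasDerivAt (pohozaev n m q γ K u) 0 c := by
    refine (hasDerivAt_const c (0 : ℝ)).congr_of_eventuallyEq ?_
    filter_upwards [Ioo_mem_nhds hc0 hc.2] with z hz using h0 z ⟨hz.1.le, hz.2.le⟩
  have h2 := hd.unique hd0
  have h3 := hpos c ⟨hc0.le, hc.2.le⟩
  have h4 := h.two_le_q
  have : 0 < c ^ n * (deriv K c * u c ^ q / q) := by positivity
  linarith

/-- The flux is nondecreasing, so beyond `r` the shot falls at least as fast as a multiple of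
`x^(-ℓ*)` with `ℓ* = (1+m)/γ`. A shot positive up to infinity must be high enough at `r` to pay for
this total drop. -/
lemma flux_rpow_le (hu : IsShot n m q K a u) (h : ShootingData n m q γ K)
    (hpos : ∀ t, 0 ≤ t → 0 < u t) {r : ℝ} (hr : 0 < r) :
    (r ^ n * fluxAvg n q K u r) ^ m ≤ (1 + m) / γ * (r ^ ((1 + m) / γ) * u r) := by
  have hm := h.one_le_m
  have hl := h.criticalRate_pos
  set l := (1 + m) / γ with hldef
  set V := (r ^ n * fluxAvg n q K u r) ^ m with hV
  have hg0 : 0 ≤ r ^ n * fluxAvg n q K u r := mul_nonneg (by positivity) (h.fluxAvg_nonneg u hr.le)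
  have hV0 : 0 ≤ V := Real.rpow_nonneg hg0 _
  have hanti : AntitoneOn (fun x => u x - V / l * x ^ (-l)) (Ici r) := by
    refine antitoneOn_of_hasDerivWithinAt_nonpos (convex_Ici r) ?_
      (f' := fun x => -(x * fluxAvg n q K u x) ^ m - V / l * (-l * x ^ (-l - 1))) ?_ ?_
    · refine hu.cont.continuousOn.sub (continuousOn_const.mul
        (continuousOn_id.rpow_const fun x hx => Or.inl (hr.trans_le hx).ne'))
    · intro x hx
      rw [interior_Ici] at hx
      have hx0 : 0 < x := hr.trans hx
      exact ((hu.hasDerivAt h hx0).sub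
        ((Real.hasDerivAt_rpow_const (Or.inl hx0.ne')).const_mul (V / l))).hasDerivWithinAt
    · intro x hx
      rw [interior_Ici] at hx
      have hx0 : 0 < x := hr.trans hx
      rw [h.slope_eq hx0 (h.fluxAvg_nonneg u hx0.le), ← hldef]
      have h1 : V ≤ (x ^ n * fluxAvg n q K u x) ^ m :=
        Real.rpow_le_rpow hg0 (h.monotoneOn_flux hu.cont hr.le hx0.le (le_of_lt hx)) (by linarith)
      have h2 : 0 < x ^ (-l - 1) := by positivity
      have h3 : V / l * (-l * x ^ (-l - 1)) = -V * x ^ (-l - 1) := by field_simp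
      rw [h3]
      nlinarith
  have hlim : Tendsto (fun x : ℝ => -(V / l * x ^ (-l))) atTop (𝓝 (-(V / l * 0))) :=
    ((tendsto_rpow_neg_atTop hl).const_mul _).neg
  have h1 : -(V / l * 0) ≤ u r - V / l * r ^ (-l) := by
    refine le_of_tendsto hlim ?_
    filter_upwards [eventually_ge_atTop r] with x hx
    have := hanti (mem_Ici.2 le_rfl) hx hx
    have h2 := hpos x (hr.le.trans hx)
    simp only at this
    linarith
  have h2 : r ^ l * r ^ (-l) = 1 := by rw [← Real.rpow_add hr]; simp
  have h3 : V / l * r ^ (-l) ≤ u r := by linarith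
  have h4 : 0 < r ^ l := by positivity
  calc V = l * (r ^ l * (V / l * r ^ (-l))) := by
        have : l * (V / l) = V := by field_simp
        linear_combination -this - V / l * l * h2
    _ ≤ _ := by gcongr

/-- Every shot crosses zero. -/
lemma exists_nonpos (hu : IsShot n m q K a u) (h : ShootingData n m q γ K)
    (hstrict : ∃ x y, 0 ≤ x ∧ x < y ∧ K x < K y) : ∃ r, 0 ≤ r ∧ u r ≤ 0 := by
  by_contra hcon
  have hpos : ∀ t, 0 ≤ t → 0 < u t := by simpa using hcon
  obtain ⟨x, y, hx, hxy, hKxy⟩ := hstrict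
  have hm := h.one_le_m
  have hq := h.two_le_q
  have hl := h.criticalRate_pos
  have ha := hu.pos
  have hγ := h.γ_pos
  have hP := hu.exists_pohozaev_pos h hx hxy hKxy fun t ht => hpos t ht.1
  set P₀ := pohozaev n m q γ K u y with hP₀
  obtain ⟨c, hc, hdec⟩ := h.exists_decay
  have hdecay : ∀ r, 0 < r → c * a ^ m * r ^ ((1 + m) / γ) * u r ≤ 1 := fun r hr =>
    hdec a u hu (r + 1) (fun t ht => hpos t ht.1) r ⟨hr, by linarith⟩
  have hVle : ∀ r, 0 < r → (r ^ n * fluxAvg n q K u r) ^ m ≤ (1 + m) / γ / (c * a ^ m) := by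
    intro r hr
    refine (hu.flux_rpow_le h hpos hr).trans ?_
    rw [le_div_iff₀ (by positivity)]
    have := hdecay r hr
    nlinarith
  set l := (1 + m) / γ with hldef
  set B := l / (c * a ^ m) with hB
  have hB0 : 0 < B := by positivity
  have hvle : ∀ r, 0 < r → r ^ n * fluxAvg n q K u r ≤ B ^ (1 / m) := by
    intro r hr
    have h0 : 0 ≤ r ^ n * fluxAvg n q K u r :=
      mul_nonneg (by positivity) (h.fluxAvg_nonneg u hr.le)
    have := Real.rpow_le_rpow (Real.rpow_nonneg h0 _) (hVle r hr) (by positivity : 0 ≤ 1 / m)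
    rwa [← Real.rpow_mul h0, mul_one_div_cancel (by linarith), Real.rpow_one] at this
  set B' := B ^ (1 / m) with hB'
  have hB'0 : 0 < B' := by positivity
  -- With bounded flux the gradient term of the functional tends to zero, and the mixed term has a
  -- favourable sign. Hence `rⁿ K u^q / q` eventually carries at least half of `P₀`.
  have hlim : Tendsto (fun r : ℝ => B' ^ (1 + m) / (1 + m) * r ^ (-l)) atTop
      (𝓝 (B' ^ (1 + m) / (1 + m) * 0)) := (tendsto_rpow_neg_atTop hl).const_mul _
  rw [mul_zero] at hlim
  obtain ⟨b, hb⟩ := ((hlim.eventually (gt_mem_nhds (half_pos hP))).and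
    ((eventually_gt_atTop 0).and (eventually_ge_atTop y))).exists_forall_of_atTop
  have hb0 : 0 < b := (hb b le_rfl).2.1
  set κ := q * P₀ / 2 * (c * a ^ m) with hκ
  have hκ0 : 0 < κ := by positivity
  -- The flux has derivative `rⁿ K u^q / (r u)`. The numerator is at least `q P₀ / 2` and `u` is at
  -- most a multiple of `r^(-l)`, so the derivative is at least `κ r^(l-1)`; the flux is then
  -- unbounded, a contradiction.
  have hmono : MonotoneOn (fun r => r ^ n * fluxAvg n q K u r - κ / l * r ^ l) (Ici b) := by
    refine monotoneOn_of_hasDerivWithinAt_nonneg (convex_Ici b) ?_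
      (f' := fun r => r ^ (n - 1) * (K r * max (u r) 0 ^ (q - 1)) - κ / l * (l * r ^ (l - 1)))
      ?_ ?_
    · have := h.continuous_fluxAvg hu.cont
      refine ContinuousOn.sub (by fun_prop) (continuousOn_const.mul
        (continuousOn_id.rpow_const fun x hx => Or.inr hl.le))
    · intro r hr
      rw [interior_Ici] at hr
      have hr0 : 0 < r := hb0.trans hr
      exact ((hasDerivAt_pow_mul_ballAvg h.n_pos (h.continuous_source hu.cont) r).sub
        ((Real.hasDerivAt_rpow_const (Or.inl hr0.ne')).const_mul _)).hasDerivWithinAt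
    · intro r hr
      rw [interior_Ici] at hr
      obtain ⟨h1, h2, h3⟩ := hb r (le_of_lt hr)
      have hur := hpos r h2.le
      have hP1 : P₀ ≤ pohozaev n m q γ K u r :=
        hu.pohozaev_monotoneOn h (S := r) (fun t ht => hpos t ht.1) ⟨hx.trans hxy.le, h3⟩
          ⟨h2.le, le_rfl⟩ h3
      have hg0 := h.fluxAvg_nonneg u h2.le
      have hP2 : pohozaev n m q γ K u r ≤
          B' ^ (1 + m) / (1 + m) * r ^ (-l) + r ^ n * (K r * u r ^ q / q) := by
        have e := h.pow_mul_slope_eq h2 hg0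
        rw [← hldef] at e
        have e2 : (r ^ n * fluxAvg n q K u r) ^ (1 + m) ≤ B' ^ (1 + m) :=
          Real.rpow_le_rpow (by positivity) (hvle r h2) (by linarith)
        have e3 : 0 ≤ r ^ n * (u r * fluxAvg n q K u r / γ) := by positivity
        have e4 : (r ^ n * fluxAvg n q K u r) ^ (1 + m) / (1 + m) * r ^ (-l)
          ≤ B' ^ (1 + m) / (1 + m) * r ^ (-l) := by gcongr
        have e5 : pohozaev n m q γ K u r = (r ^ n * fluxAvg n q K u r) ^ (1 + m) / (1 + m) * r ^ (-l)
            + r ^ n * (K r * u r ^ q / q) - r ^ n * (u r * fluxAvg n q K u r / γ) := by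
          rw [pohozaev, pohozaevDensity]
          linear_combination e / (1 + m)
        linarith
      have h4 : q * P₀ / 2 ≤ r ^ n * (K r * u r ^ q) := by
        have : r ^ n * (K r * u r ^ q) = q * (r ^ n * (K r * u r ^ q / q)) := by field_simp
        rw [this]
        nlinarith
      rw [max_eq_left hur.le]
      have e1 : κ / l * (l * r ^ (l - 1)) = κ * r ^ (l - 1) := by field_simp
      have e2 : u r ^ q = u r * u r ^ (q - 1) := by
        rw [Real.rpow_sub_one hur.ne']; field_simp
      have e3 : r ^ n = r * r ^ (n - 1) := by
        rw [← pow_succ', Nat.sub_add_cancel h.n_pos]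
      have e4 : r ^ l = r * r ^ (l - 1) := by
        rw [Real.rpow_sub_one h2.ne']; field_simp
      have h5 := hdecay r h2
      rw [e1, sub_nonneg]
      rw [e4] at h5
      rw [e2, e3] at h4
      have h6 : 0 < r * u r := by positivity
      refine le_of_mul_le_mul_left ?_ h6
      calc r * u r * (κ * r ^ (l - 1)) = q * P₀ / 2 * (c * a ^ m * (r * r ^ (l - 1)) * u r) := by
            rw [hκ]; ring
        _ ≤ q * P₀ / 2 * 1 := by gcongr
        _ ≤ _ := by linarith
  have hinf : Tendsto (fun r : ℝ => κ / l * r ^ l) atTop atTop :=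
    (tendsto_rpow_atTop hl).const_mul_atTop (by positivity)
  obtain ⟨r, hr1, hr2⟩ := ((hinf.eventually (eventually_gt_atTop
    (B' + κ / l * b ^ l))).and (eventually_ge_atTop b)).exists
  have h1 := hmono (mem_Ici.2 le_rfl) hr2 hr2
  have h2 := hvle r (hb0.trans_le hr2)
  have h3 : 0 ≤ b ^ n * fluxAvg n q K u b := mul_nonneg (by positivity) (h.fluxAvg_nonneg u hb0.le)
  simp only at h1
  linarith

end IsShot

/-! ### Lower bounds for the first zero -/

namespace IsShot

/-- Exhibits the natural length scale `a^(-γ)` of the shot: the relative drop is controlled by a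
power of `r a^γ`. -/
lemma init_mul_le (hu : IsShot n m q K a u) (h : ShootingData n m q γ K) {r M : ℝ}
    (hr : 0 ≤ r) (hrM : r ≤ M) :
    a * (1 - r ^ (1 + m) * K M ^ m * a ^ (γ * (1 + m))) ≤ u r := by
  have hm := h.one_le_m
  have ha := hu.pos
  have hKM := h.pos M
  have hKr := h.pos r
  have h1 := hu.init_sub_le h hr
  have h2 : r * (r * (K r * a ^ (q - 1))) ^ m ≤ a * (r ^ (1 + m) * K M ^ m * a ^ (γ * (1 + m))) := by
    rw [Real.mul_rpow hr (by positivity), Real.mul_rpow hKr.le (by positivity),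
      ← Real.rpow_mul ha.le]
    have e1 : a ^ ((q - 1) * m) = a * a ^ (γ * (1 + m)) := by
      rw [← Real.rpow_one_add' ha.le (by have := h.γ_pos; positivity)]
      congr 1
      linear_combination h.q_mul
    have e2 : r ^ (1 + m) = r * r ^ m := Real.rpow_one_add' hr (by linarith)
    have e3 : K r ^ m ≤ K M ^ m := Real.rpow_le_rpow hKr.le (h.mono hrM) (by linarith)
    rw [e1, e2]
    calc _ = a * (r * r ^ m * K r ^ m * a ^ (γ * (1 + m))) := by ring
      _ ≤ _ := by gcongr
  linarith

/-- A zero `R ≤ M` is bounded below in terms of the initial value. -/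
lemma one_le_of_zero (hu : IsShot n m q K a u) (h : ShootingData n m q γ K) {R M : ℝ}
    (hR : 0 < R) (hRM : R ≤ M) (h0 : u R = 0) :
    1 ≤ R ^ (1 + m) * K M ^ m * a ^ (γ * (1 + m)) := by
  have h1 := hu.init_mul_le h hR.le hRM
  rw [h0] at h1
  have := nonpos_of_mul_nonpos_right h1 hu.pos
  linarith

end IsShot

/-- On `[0, c a^(-γ)]` the shot stays above half its initial value. -/
lemma ShootingData.exists_half_le (h : ShootingData n m q γ K) (M : ℝ) :
    ∃ c : ℝ, 0 < c ∧ ∀ (a : ℝ) (u : ℝ → ℝ), IsShot n m q K a u →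
      ∀ r, 0 ≤ r → r ≤ M → r ≤ c * a ^ (-γ) → a / 2 ≤ u r := by
  have hm := h.one_le_m
  have hKM := h.pos M
  refine ⟨(1 / (2 * K M ^ m)) ^ (1 / (1 + m)), by positivity, fun a u hu r hr hrM hrc => ?_⟩
  have ha := hu.pos
  have h1 := hu.init_mul_le h hr hrM
  have h3 : r ^ (1 + m) ≤ 1 / (2 * K M ^ m) * a ^ (-(γ * (1 + m))) := by
    calc r ^ (1 + m) ≤ ((1 / (2 * K M ^ m)) ^ (1 / (1 + m)) * a ^ (-γ)) ^ (1 + m) :=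
          Real.rpow_le_rpow hr hrc (by linarith)
      _ = _ := by
          rw [Real.mul_rpow (by positivity) (by positivity), ← Real.rpow_mul (by positivity),
            ← Real.rpow_mul ha.le, div_mul_cancel₀ _ (by linarith), Real.rpow_one, neg_mul]
  have h4 : a ^ (-(γ * (1 + m))) * a ^ (γ * (1 + m)) = 1 := by rw [← Real.rpow_add ha]; simp
  have h5 : r ^ (1 + m) * K M ^ m * a ^ (γ * (1 + m)) ≤ 1 / 2 := by
    calc _ ≤ 1 / (2 * K M ^ m) * a ^ (-(γ * (1 + m))) * K M ^ m * a ^ (γ * (1 + m)) := by gcongr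
      _ = 1 / (2 * K M ^ m) * K M ^ m * (a ^ (-(γ * (1 + m))) * a ^ (γ * (1 + m))) := by ring
      _ = 1 / 2 := by rw [h4]; field_simp
  nlinarith

/-! ### Effect of the flatness of `K` on shots with large central value -/

section LargeInit

variable {M C l : ℝ}

/-- Integrates the derivative of the functional using the crude bound `u ≤ a`, which is efficient
only up to the scale `a^(-γ)`. -/
lemma IsShot.pohozaev_le_near (hu : IsShot n m q K a u) (h : ShootingData n m q γ K)
    (hl : 0 < l) (hKd : ∀ r ∈ Ioc 0 M, r * deriv K r ≤ C * r ^ l) {R : ℝ} (hRM : R ≤ M)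
    (hpos : ∀ t ∈ Ico 0 R, 0 < u t) {r₀ : ℝ} (hr₀ : 0 ≤ r₀) (hrR : r₀ ≤ R) :
    pohozaev n m q γ K u r₀ ≤ C / (q * (n + l)) * a ^ q * r₀ ^ (n + l) := by
  have hq := h.two_le_q
  have ha := hu.pos
  have hmono : MonotoneOn (fun r => C / (q * (n + l)) * a ^ q * r ^ (n + l)
      - pohozaev n m q γ K u r) (Icc 0 r₀) := by
    refine monotoneOn_of_hasDerivWithinAt_nonneg (convex_Icc 0 r₀) ?_
      (f' := fun r => C / (q * (n + l)) * a ^ q * ((n + l) * r ^ ((n : ℝ) + l - 1))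
        - r ^ n * (deriv K r * u r ^ q / q)) ?_ ?_
    · exact (continuousOn_const.mul (continuousOn_id.rpow_const fun x hx => Or.inr
        (by positivity))).sub (h.continuous_pohozaev hu.cont).continuousOn
    · intro r hr
      rw [interior_Icc] at hr
      exact (((Real.hasDerivAt_rpow_const (Or.inl hr.1.ne')).const_mul _).sub
        (hu.hasDerivAt_pohozaev h hr.1 (hpos r ⟨hr.1.le, hr.2.trans_le hrR⟩))).hasDerivWithinAt
    · intro r hr
      rw [interior_Icc] at hr
      have hr0 := hr.1
      have hur := hpos r ⟨hr.1.le, hr.2.trans_le hrR⟩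
      have h1 := hKd r ⟨hr.1, (hr.2.le.trans hrR).trans hRM⟩
      have h2 : u r ^ q ≤ a ^ q := Real.rpow_le_rpow hur.le (hu.le_init h hr0.le) (by linarith)
      have e1 : r ^ ((n : ℝ) + l - 1) = r ^ ((n : ℝ) - 1) * r ^ l := by
        rw [← Real.rpow_add hr0]; congr 1; ring
      have e2 : r ^ n = r ^ ((n : ℝ) - 1) * r := by
        rw [← Real.rpow_add_one hr0.ne', sub_add_cancel, Real.rpow_natCast]
      have hk := h.deriv_nonneg r
      have e3 : C / (q * (n + l)) * a ^ q * ((n + l) * (r ^ ((n : ℝ) - 1) * r ^ l))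
          = r ^ ((n : ℝ) - 1) * (C * r ^ l) * a ^ q / q := by
        have : (n : ℝ) + l ≠ 0 := by positivity
        field_simp
      rw [e1, e2, e3, sub_nonneg]
      calc _ = r ^ ((n : ℝ) - 1) * (r * deriv K r) * u r ^ q / q := by ring
        _ ≤ _ := by
          have : 0 ≤ r * deriv K r := by positivity
          have : 0 ≤ C * r ^ l := this.trans h1
          gcongr
  have h0 := hmono ⟨le_rfl, hr₀⟩ ⟨hr₀, le_rfl⟩ hr₀
  simp only [pohozaev_zero h, Real.zero_rpow (by positivity : (n : ℝ) + l ≠ 0)] at h0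
  linarith

/-- Beyond `r₀` the decay bound replaces `u ≤ a`. The integrand becomes a multiple of `r^(l - n m -
1)`, integrable at infinity because `l < n m`, so the bound does not depend on `R`. -/
lemma IsShot.pohozaev_le_far (hu : IsShot n m q K a u) (h : ShootingData n m q γ K)
    (hln : l < n * m) (hKd : ∀ r ∈ Ioc 0 M, r * deriv K r ≤ C * r ^ l) {R : ℝ} (hRM : R ≤ M)
    (hpos : ∀ t ∈ Ico 0 R, 0 < u t) {c : ℝ} (hc : 0 < c)
    (hdec : ∀ r ∈ Ioo 0 R, c * a ^ m * r ^ ((1 + m) / γ) * u r ≤ 1)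
    {r₀ : ℝ} (hr₀ : 0 < r₀) (hrR : r₀ ≤ R) (hC : 0 ≤ C) :
    pohozaev n m q γ K u R ≤ pohozaev n m q γ K u r₀ +
      C / (q * (n * m - l)) * (c * a ^ m) ^ (-q) * r₀ ^ (l - n * m) := by
  have hq := h.two_le_q
  have ha := hu.pos
  have hγ := h.γ_pos
  have hnm : 0 < n * m - l := by linarith
  set D := C / (q * (n * m - l)) * (c * a ^ m) ^ (-q) with hD
  have hD0 : 0 ≤ D := by positivity
  have hanti : AntitoneOn (fun r => pohozaev n m q γ K u r + D * r ^ (l - n * m)) (Icc r₀ R) := by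
    refine antitoneOn_of_hasDerivWithinAt_nonpos (convex_Icc r₀ R) ?_
      (f' := fun r => r ^ n * (deriv K r * u r ^ q / q)
        + D * ((l - n * m) * r ^ (l - n * m - 1))) ?_ ?_
    · exact (h.continuous_pohozaev hu.cont).continuousOn.add
        (continuousOn_const.mul (continuousOn_id.rpow_const fun x hx => Or.inl
        (hr₀.trans_le hx.1).ne'))
    · intro r hr
      rw [interior_Icc] at hr
      have hr0 : 0 < r := hr₀.trans hr.1
      exact ((hu.hasDerivAt_pohozaev h hr0 (hpos r ⟨hr0.le, hr.2⟩)).add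
        ((Real.hasDerivAt_rpow_const (Or.inl hr0.ne')).const_mul _)).hasDerivWithinAt
    · intro r hr
      rw [interior_Icc] at hr
      have hr0 : 0 < r := hr₀.trans hr.1
      have hur := hpos r ⟨hr0.le, hr.2⟩
      have h1 := hKd r ⟨hr0, hr.2.le.trans hRM⟩
      have hk := h.deriv_nonneg r
      have h3 := hdec r ⟨hr0, hr.2⟩
      have h2 : u r ^ q ≤ (c * a ^ m) ^ (-q) * r ^ (-(n * (1 + m))) := by
        have h4 : u r ≤ (c * a ^ m * r ^ ((1 + m) / γ))⁻¹ := by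
          rw [← one_div, le_div_iff₀ (by positivity)]; linarith
        have h5 := Real.rpow_le_rpow hur.le h4 (by linarith : 0 ≤ q)
        rw [Real.inv_rpow (by positivity), ← Real.rpow_neg (by positivity),
          Real.mul_rpow (by positivity) (by positivity), ← Real.rpow_mul hr0.le] at h5
        have e : (1 + m) / γ * -q = -(n * (1 + m)) := by rw [h.q_eq]; field_simp
        rwa [e] at h5
      have e1 : r ^ (l - n * m - 1) = r ^ ((n : ℝ) - 1) * r ^ l * r ^ (-(n * (1 + m))) := by
        rw [← Real.rpow_add hr0, ← Real.rpow_add hr0]; congr 1; ring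
      have e2 : r ^ n = r ^ ((n : ℝ) - 1) * r := by
        rw [← Real.rpow_add_one hr0.ne', sub_add_cancel, Real.rpow_natCast]
      have e3 : D * ((l - n * m) * r ^ (l - n * m - 1)) = -(r ^ ((n : ℝ) - 1) * (C * r ^ l) *
          ((c * a ^ m) ^ (-q) * r ^ (-(n * (1 + m)))) / q) := by
        rw [e1, hD]; field_simp; ring
      rw [e3, e2, ← sub_eq_add_neg, sub_nonpos]
      calc _ = r ^ ((n : ℝ) - 1) * (r * deriv K r) * u r ^ q / q := by ring
        _ ≤ _ := by gcongr
  have h0 := hanti ⟨le_rfl, hrR⟩ ⟨hrR, le_rfl⟩ hrR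
  simp only at h0
  have : 0 ≤ D * R ^ (l - n * m) := mul_nonneg hD0 (Real.rpow_nonneg (hr₀.le.trans hrR) _)
  linarith

/-- Lower bound for the first zero in terms of the flatness of `K` at the origin. -/
lemma ShootingData.exists_zero_ge (h : ShootingData n m q γ K) (hl : 0 < l) (hln : l < n * m)
    (hC : 0 < C) (hKd : ∀ r ∈ Ioc 0 M, r * deriv K r ≤ C * r ^ l) :
    ∃ c : ℝ, 0 < c ∧ ∀ (a R : ℝ) (u : ℝ → ℝ), IsShot n m q K a u → 0 < R → R ≤ M → u R = 0 →
      (∀ t ∈ Ico 0 R, 0 < u t) → c * a ^ (γ * l - (1 + m)) ≤ R ^ ((1 + m) / γ) := by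
  have hm := h.one_le_m
  have hq := h.two_le_q
  have hγ := h.γ_pos
  have hn := h.n_pos
  have hK0 := h.pos 0
  obtain ⟨c₀, hc₀, hhalf⟩ := h.exists_half_le M
  obtain ⟨c₁, hc₁, hdec⟩ := h.exists_decay
  have hnm : 0 < n * m - l := by linarith
  set β := (1 + γ) / m with hβ
  set b := c₀ ^ n * (K 0 / n * (1 / 2) ^ β) with hb
  have hb0 : 0 < b := by positivity
  set E := C / (q * (n + l)) * c₀ ^ (n + l)
    + C / (q * (n * m - l)) * c₁ ^ (-q) * c₀ ^ (l - n * m) with hE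
  have hE0 : 0 < E := by positivity
  refine ⟨b ^ (1 + m) / (1 + m) / E, by positivity, fun a R u hu hR hRM huR hpos => ?_⟩
  have ha := hu.pos
  -- At this radius the near and far estimates have the same order `a^(-γ l)`, and the shot is still
  -- at least `a / 2`.
  set r₀ := c₀ * a ^ (-γ) with hr₀def
  have hr₀ : 0 < r₀ := by positivity
  have hrR : r₀ < R := by
    by_contra hle
    have := hhalf a u hu R hR.le hRM (not_lt.1 hle)
    rw [huR] at this
    linarith
  -- The flux only increases after `r₀`, where its size is `a^(-q) a^γ a^β = a^(-1)`.
  have hflux : b * a ^ (-1 : ℝ) ≤ R ^ n * fluxAvg n q K u R := by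
    refine le_trans ?_ (h.monotoneOn_flux hu.cont hr₀.le hR.le hrR.le)
    have h1 := hu.fluxAvg_ge h hpos ⟨hr₀.le, hrR⟩
    have h2 := hhalf a u hu r₀ hr₀.le (hrR.le.trans hRM) le_rfl
    have h3 : (a / 2) ^ β ≤ u r₀ ^ β := Real.rpow_le_rpow (by positivity) h2 (by positivity)
    have e1 : (a / 2) ^ β = a ^ β * (1 / 2) ^ β := by
      rw [← Real.mul_rpow ha.le (by norm_num)]; congr 1; ring
    have e2 : r₀ ^ n = c₀ ^ n * a ^ (-q) := by
      rw [hr₀def, mul_pow, ← Real.rpow_mul_natCast ha.le, h.q_eq]; congr 2; ring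
    have e3 : a ^ (-1 : ℝ) = a ^ (-q) * a ^ γ * a ^ β := by
      rw [← Real.rpow_add ha, ← Real.rpow_add ha]
      congr 1
      rw [hβ]
      field_simp
      linear_combination h.q_mul
    calc b * a ^ (-1 : ℝ) = r₀ ^ n * (K 0 / n * a ^ γ * (a / 2) ^ β) := by
          rw [e1, e2, e3, hb]; ring
      _ ≤ r₀ ^ n * (K 0 / n * a ^ γ * u r₀ ^ β) := by gcongr
      _ ≤ _ := mul_le_mul_of_nonneg_left h1 (by positivity)
  -- At the zero only the gradient term of the functional survives, and it is a power of the flux.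
  have hlower : b ^ (1 + m) / (1 + m) * a ^ (-(1 + m)) * R ^ (-((1 + m) / γ))
      ≤ pohozaev n m q γ K u R := by
    have e := h.pow_mul_slope_eq hR (h.fluxAvg_nonneg u hR.le)
    have e5 : pohozaev n m q γ K u R =
        (R ^ n * fluxAvg n q K u R) ^ (1 + m) / (1 + m) * R ^ (-((1 + m) / γ)) := by
      rw [pohozaev, pohozaevDensity, huR, Real.zero_rpow (by linarith)]
      linear_combination e / (1 + m)
    rw [e5]
    have h1 := Real.rpow_le_rpow (by positivity) hflux (by linarith : 0 ≤ 1 + m)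
    rw [Real.mul_rpow hb0.le (by positivity), ← Real.rpow_mul ha.le, neg_one_mul] at h1
    calc _ = b ^ (1 + m) * a ^ (-(1 + m)) / (1 + m) * R ^ (-((1 + m) / γ)) := by ring
      _ ≤ _ := by gcongr
  have hupper : pohozaev n m q γ K u R ≤ E * a ^ (-(γ * l)) := by
    have h1 := hu.pohozaev_le_near h hl hKd hRM hpos hr₀.le hrR.le
    have h2 := hu.pohozaev_le_far h hln hKd hRM hpos hc₁ (hdec a u hu R hpos) hr₀ hrR.le hC.le
    have e1 : a ^ q * r₀ ^ (n + l) = c₀ ^ (n + l) * a ^ (-(γ * l)) := by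
      rw [hr₀def, Real.mul_rpow hc₀.le (by positivity), ← Real.rpow_mul ha.le, mul_left_comm,
        ← Real.rpow_add ha]
      congr 2
      rw [h.q_eq]; ring
    have e2 : (c₁ * a ^ m) ^ (-q) * r₀ ^ (l - n * m) =
        c₁ ^ (-q) * c₀ ^ (l - n * m) * a ^ (-(γ * l)) := by
      have e3 : a ^ (-(γ * l)) = a ^ (m * -q) * a ^ (-γ * (l - n * m)) := by
        rw [← Real.rpow_add ha]
        congr 1
        rw [h.q_eq]; ring
      rw [hr₀def, Real.mul_rpow hc₁.le (by positivity), Real.mul_rpow hc₀.le (by positivity),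
        ← Real.rpow_mul ha.le, ← Real.rpow_mul ha.le, e3]
      ring
    calc _ ≤ _ := h2
      _ ≤ C / (q * (n + l)) * a ^ q * r₀ ^ (n + l) +
        C / (q * (n * m - l)) * (c₁ * a ^ m) ^ (-q) * r₀ ^ (l - n * m) := by linarith
      _ = E * a ^ (-(γ * l)) := by
        rw [hE]
        linear_combination C / (q * (n + l)) * e1 + C / (q * (n * m - l)) * e2
  have h1 := hlower.trans hupper
  have hRl : 0 < R ^ ((1 + m) / γ) := by positivity
  have e1 : R ^ (-((1 + m) / γ)) * R ^ ((1 + m) / γ) = 1 := by rw [← Real.rpow_add hR]; simp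
  have e2 : a ^ (-(γ * l)) * a ^ (γ * l) = 1 := by rw [← Real.rpow_add ha]; simp
  have e3 : a ^ (γ * l - (1 + m)) = a ^ (-(1 + m)) * a ^ (γ * l) := by
    rw [← Real.rpow_add ha]; congr 1; ring
  have h2 : b ^ (1 + m) / (1 + m) * a ^ (γ * l - (1 + m)) ≤ E * R ^ ((1 + m) / γ) := by
    calc _ = b ^ (1 + m) / (1 + m) * a ^ (-(1 + m)) * R ^ (-((1 + m) / γ)) *
          (R ^ ((1 + m) / γ) * a ^ (γ * l)) := by
          rw [e3]; linear_combination -(b ^ (1 + m) / (1 + m) * a ^ (-(1 + m)) * a ^ (γ * l)) * e1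
      _ ≤ E * a ^ (-(γ * l)) * (R ^ ((1 + m) / γ) * a ^ (γ * l)) := by gcongr
      _ = _ := by linear_combination E * R ^ ((1 + m) / γ) * e2
  rw [div_mul_eq_mul_div, div_le_iff₀ hE0]
  linarith

end LargeInit

/-! ### The zero map -/

/-- `R` is the first zero of the shot with initial value `a`. -/
def IsShotZero (n : ℕ) (m q : ℝ) (K : ℝ → ℝ) (a R : ℝ) : Prop :=
  ∃ u, IsShot n m q K a u ∧ 0 < R ∧ u R = 0 ∧ ∀ t ∈ Ico 0 R, 0 < u t

lemma IsShot.exists_first_zero (hu : IsShot n m q K a u) (h : ShootingData n m q γ K)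
    (hstrict : ∃ x y, 0 ≤ x ∧ x < y ∧ K x < K y) :
    ∃ R, 0 < R ∧ u R = 0 ∧ ∀ t ∈ Ico 0 R, 0 < u t := by
  obtain ⟨r, hr, hur⟩ := hu.exists_nonpos h hstrict
  set A := {t | 0 ≤ t ∧ u t ≤ 0} with hA
  have hAc : IsClosed A :=
    (isClosed_le continuous_const continuous_id).inter (isClosed_le hu.cont continuous_const)
  have hAb : BddBelow A := ⟨0, fun t ht => ht.1⟩
  have hAn : A.Nonempty := ⟨r, hr, hur⟩
  have hmem : sInf A ∈ A := hAc.csInf_mem hAn hAb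
  have hlt : ∀ t ∈ Ico 0 (sInf A), 0 < u t := fun t ht => by
    by_contra hcon
    exact absurd (csInf_le hAb ⟨ht.1, not_lt.1 hcon⟩) (not_le.2 ht.2)
  have hpos : 0 < sInf A := by
    rcases hmem.1.eq_or_lt with h0 | h0
    · have h1 := hmem.2
      rw [← h0, hu.apply_zero] at h1
      exact absurd h1 (not_le.2 hu.pos)
    · exact h0
  refine ⟨sInf A, hpos, le_antisymm hmem.2 ?_, hlt⟩
  have hc : ContinuousWithinAt u (Ico 0 (sInf A)) (sInf A) := hu.cont.continuousWithinAt
  have hcl : sInf A ∈ closure (Ico 0 (sInf A)) := by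
    rw [closure_Ico hpos.ne]; exact ⟨hpos.le, le_rfl⟩
  have := mem_closure_iff_nhdsWithin_neBot.1 hcl
  exact ge_of_tendsto hc.tendsto
    (eventually_of_mem self_mem_nhdsWithin fun t ht => (hlt t ht).le)

/-- The flux is positive before `R` and never decreases, so the slope stays strictly negative from
`R` on. This transversality makes the first zero continuous in `a`. -/
lemma IsShot.neg_of_gt (hu : IsShot n m q K a u) (h : ShootingData n m q γ K) {R r : ℝ}
    (hR : 0 < R) (hz : u R = 0) (hpos : ∀ t ∈ Ico 0 R, 0 < u t) (hr : R < r) : u r < 0 := by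
  have hslope : ∀ x, R ≤ x → 0 < (x * fluxAvg n q K u x) ^ m := by
    intro x hx
    have hx0 : 0 < x := hR.trans_le hx
    have h2 : 0 < R / 2 := half_pos hR
    have h1 := hu.fluxAvg_ge h hpos (r := R / 2) ⟨h2.le, by linarith⟩
    have h3 := hpos (R / 2) ⟨h2.le, by linarith⟩
    have hK := h.pos 0
    have ha := hu.pos
    have hn := h.n_pos
    have h4 : 0 < fluxAvg n q K u (R / 2) := lt_of_lt_of_le (by positivity) h1
    have h5 : (R / 2) ^ n * fluxAvg n q K u (R / 2) ≤ x ^ n * fluxAvg n q K u x :=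
      h.monotoneOn_flux hu.cont h2.le hx0.le (by linarith)
    have h6 : 0 < x ^ n * fluxAvg n q K u x := lt_of_lt_of_le (by positivity) h5
    have h7 : 0 < fluxAvg n q K u x := pos_of_mul_pos_right h6 (by positivity)
    positivity
  have hanti : StrictAntiOn u (Icc R r) := by
    refine strictAntiOn_of_deriv_neg (convex_Icc R r) hu.cont.continuousOn fun x hx => ?_
    rw [interior_Icc] at hx
    rw [(hu.hasDerivAt h (hR.trans hx.1)).deriv]
    linarith [hslope x hx.1.le]
  rw [← hz]
  exact hanti ⟨le_rfl, hr.le⟩ ⟨hr.le, le_rfl⟩ hr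

lemma IsShot.pos_iff (hu : IsShot n m q K a u) (h : ShootingData n m q γ K) {R r : ℝ}
    (hR : 0 < R) (hz : u R = 0) (hpos : ∀ t ∈ Ico 0 R, 0 < u t) (hr : 0 ≤ r) :
    0 < u r ↔ r < R := by
  refine ⟨fun h1 => ?_, fun h1 => hpos r ⟨hr, h1⟩⟩
  by_contra hcon
  rcases (not_lt.1 hcon).eq_or_lt with rfl | h2
  · exact h1.ne' hz
  · exact absurd (hu.neg_of_gt h hR hz hpos h2) (not_lt.2 h1.le)

/-- A solution of the integrated equation on `[0, T]` agrees there with the shot. -/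
lemma ShootingData.eqOn (h : ShootingData n m q γ K) {w : ℝ → ℝ} (hu : IsShot n m q K a u)
    {T : ℝ} (hT : 0 ≤ T) (hw : Continuous w)
    (he : ∀ r ∈ Icc 0 T, w r = a - ∫ x in (0 : ℝ)..r, (x * fluxAvg n q K w x) ^ m) :
    EqOn u w (Icc 0 T) := by
  obtain ⟨L, -, hL⟩ := h.exists_dependence hu.pos.le hT
  intro r hr
  have := hL a a u w le_rfl le_rfl hu.cont hw (fun r hr => hu.eq r hr.1) he r hr
  rw [sub_self, abs_zero, mul_zero] at this
  exact sub_eq_zero.1 (abs_nonpos_iff.1 this)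

lemma ShootingData.isShot_unique (h : ShootingData n m q γ K) {w : ℝ → ℝ}
    (hu : IsShot n m q K a u) (hw : IsShot n m q K a w) {r : ℝ} (hr : 0 ≤ r) : u r = w r :=
  h.eqOn hu hr hw.cont (fun r hr => hw.eq r hr.1) ⟨hr, le_rfl⟩

/-- The first zero is a continuous function of the initial value. -/
lemma ShootingData.exists_zero_map (h : ShootingData n m q γ K)
    (hstrict : ∃ x y, 0 ≤ x ∧ x < y ∧ K x < K y) :
    ∃ ρ : ℝ → ℝ, (∀ a R, 0 < a → (IsShotZero n m q K a R ↔ R = ρ a)) ∧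
      ContinuousOn ρ (Ioi 0) := by
  have hex : ∀ a : ℝ, ∃ R : ℝ, ∃ u : ℝ → ℝ, 0 < a → IsShot n m q K a u ∧ 0 < R ∧ u R = 0 ∧
      ∀ t ∈ Ico 0 R, 0 < u t := by
    intro a
    by_cases ha : 0 < a
    · obtain ⟨u, hu⟩ := h.exists_isShot ha
      obtain ⟨R, hR⟩ := hu.exists_first_zero h hstrict
      exact ⟨R, u, fun _ => ⟨hu, hR⟩⟩
    · exact ⟨0, fun _ => 0, fun h => absurd h ha⟩
  choose ρ w hw using hex
  refine ⟨ρ, fun a R ha => ⟨?_, ?_⟩, ?_⟩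
  · rintro ⟨u, hu, hR, hz, hpos⟩
    obtain ⟨hu', hR', hz', hpos'⟩ := hw a ha
    rcases lt_trichotomy R (ρ a) with h1 | h1 | h1
    · have h2 := hpos' R ⟨hR.le, h1⟩
      rw [← h.isShot_unique hu hu' hR.le, hz] at h2
      exact absurd h2 (lt_irrefl _)
    · exact h1
    · have h2 := hpos (ρ a) ⟨hR'.le, h1⟩
      rw [h.isShot_unique hu hu' hR'.le, hz'] at h2
      exact absurd h2 (lt_irrefl _)
  · rintro rfl
    exact ⟨w a, hw a ha⟩
  · intro a ha
    refine ContinuousAt.continuousWithinAt ?_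
    have ha' : 0 < a := ha
    obtain ⟨hu, hR, hz, hpos⟩ := hw a ha
    obtain ⟨L, hL0, hL⟩ := h.exists_dependence (Λ := a + 1) (T := ρ a + 1) (by linarith)
      (by linarith)
    have hclose : ∀ r ∈ Icc 0 (ρ a + 1), Tendsto (fun b => w b r) (𝓝 a) (𝓝 (w a r)) := by
      intro r hr
      rw [tendsto_iff_norm_sub_tendsto_zero]
      have hlim : Tendsto (fun b => L * |b - a|) (𝓝 a) (𝓝 0) := by
        have : Continuous fun b => L * |b - a| := by fun_prop
        simpa using this.tendsto a
      refine tendsto_of_tendsto_of_tendsto_of_le_of_le' tendsto_const_nhds hlim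
        (Eventually.of_forall fun b => norm_nonneg _) ?_
      filter_upwards [Ioo_mem_nhds ha' (show a < a + 1 by linarith)] with b hb
      exact hL b a (w b) (w a) hb.2.le (by linarith) (hw b hb.1).1.cont hu.cont
        (fun r hr => (hw b hb.1).1.eq r hr.1) (fun r hr => hu.eq r hr.1) r hr
    -- The shot is positive just before its zero and negative just after; nearby shots keep both
    -- signs, which traps their first zeros.
    rw [ContinuousAt, tendsto_order]
    constructor
    · intro x hx
      set x' := max x (ρ a / 2)
      have hx' : x' < ρ a := max_lt hx (by linarith)
      have hx0 : 0 ≤ x' := (half_pos hR).le.trans (le_max_right _ _)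
      filter_upwards [(hclose x' ⟨hx0, by linarith⟩).eventually
        (lt_mem_nhds (hpos x' ⟨hx0, hx'⟩)), Ioi_mem_nhds ha'] with b hb hb0
      obtain ⟨h1, h2, h3, h4⟩ := hw b hb0
      exact (le_max_left _ _).trans_lt ((h1.pos_iff h h2 h3 h4 hx0).1 hb)
    · intro x hx
      set x' := min x (ρ a + 1)
      have hx' : ρ a < x' := lt_min hx (by linarith)
      have hx0 : 0 ≤ x' := hR.le.trans hx'.le
      filter_upwards [(hclose x' ⟨hx0, min_le_right _ _⟩).eventually
        (gt_mem_nhds (hu.neg_of_gt h hR hz hpos hx')), Ioi_mem_nhds ha'] with b hb hb0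
      obtain ⟨h1, h2, h3, h4⟩ := hw b hb0
      by_contra hcon
      have hlt : x' ≤ ρ b := (min_le_left _ _).trans (not_lt.1 hcon)
      rcases hlt.eq_or_lt with h5 | h5
      · rw [h5, h3] at hb; exact lt_irrefl _ hb
      · exact absurd hb (not_lt.2 (h4 x' ⟨hx0, h5⟩).le)

end Shot

/-! ### Calculus of radial functions and fields -/

section Radial

variable {n : ℕ}

lemma hasFDerivAt_norm_of_ne {x : EuclideanSpace ℝ (Fin n)} (hx : x ≠ 0) :
    HasFDerivAt (fun y : EuclideanSpace ℝ (Fin n) => ‖y‖) (‖x‖⁻¹ • innerSL ℝ x) x := by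
  have h := ((hasStrictFDerivAt_norm_sq x).hasFDerivAt).sqrt
    (pow_ne_zero 2 (norm_ne_zero_iff.2 hx))
  simp only [Real.sqrt_sq (norm_nonneg _)] at h
  refine h.congr_fderiv ?_
  have := norm_ne_zero_iff.2 hx
  ext v
  simp
  field_simp

lemma hasGradientAt_radial {f : ℝ → ℝ} {f' : ℝ} {x : EuclideanSpace ℝ (Fin n)} (hx : x ≠ 0)
    (hf : HasDerivAt f f' ‖x‖) :
    HasGradientAt (fun y : EuclideanSpace ℝ (Fin n) => f ‖y‖) ((f' / ‖x‖) • x) x := by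
  rw [hasGradientAt_iff_hasFDerivAt]
  refine (hf.comp_hasFDerivAt x (hasFDerivAt_norm_of_ne hx)).congr_fderiv ?_
  ext v
  simp [InnerProductSpace.toDual_apply_apply]
  ring

lemma hasFDerivAt_radial_field {G : ℝ → ℝ} {G' : ℝ} {x : EuclideanSpace ℝ (Fin n)} (hx : x ≠ 0)
    (hG : HasDerivAt G G' ‖x‖) :
    HasFDerivAt (fun y : EuclideanSpace ℝ (Fin n) => G ‖y‖ • y)
      (G ‖x‖ • ContinuousLinearMap.id ℝ _ + (G' • (‖x‖⁻¹ • innerSL ℝ x)).smulRight x) x :=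
  (hG.comp_hasFDerivAt x (hasFDerivAt_norm_of_ne hx)).smul (hasFDerivAt_id x)

lemma divergence_radial_field {G : ℝ → ℝ} {G' : ℝ} {x : EuclideanSpace ℝ (Fin n)} (hx : x ≠ 0)
    (hG : HasDerivAt G G' ‖x‖) :
    divergence (fun y : EuclideanSpace ℝ (Fin n) => G ‖y‖ • y) x = n * G ‖x‖ + ‖x‖ * G' := by
  have hx' := norm_ne_zero_iff.2 hx
  have hsq : ∑ i : Fin n, x i * x i = ‖x‖ ^ 2 := by
    rw [EuclideanSpace.real_norm_sq_eq]
    exact Finset.sum_congr rfl fun i _ => by ring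
  rw [divergence, (hasFDerivAt_radial_field hx hG).fderiv]
  have : ∀ i : Fin n, ((G ‖x‖ • ContinuousLinearMap.id ℝ (EuclideanSpace ℝ (Fin n)) +
      (G' • (‖x‖⁻¹ • innerSL ℝ x)).smulRight x) (EuclideanSpace.single i 1)) i
      = G ‖x‖ + G' * ‖x‖⁻¹ * (x i * x i) := by
    intro i
    simp [EuclideanSpace.inner_single_right]
    ring
  rw [Finset.sum_congr rfl fun i _ => this i, Finset.sum_add_distrib, ← Finset.mul_sum, hsq]
  simp
  field_simp

/-- At the origin continuity of `G` suffices, because the field minus `G 0 • y` is `o(‖y‖)`. This is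
why the flux is written through an average that is continuous at `0`. -/
lemma hasFDerivAt_radial_field_zero {G : ℝ → ℝ} (hG : ContinuousAt G 0) :
    HasFDerivAt (fun y : EuclideanSpace ℝ (Fin n) => G ‖y‖ • y)
      (G 0 • ContinuousLinearMap.id ℝ (EuclideanSpace ℝ (Fin n))) 0 := by
  rw [hasFDerivAt_iff_isLittleO_nhds_zero]
  have h1 : Tendsto (fun y : EuclideanSpace ℝ (Fin n) => G ‖y‖ - G 0) (𝓝 0) (𝓝 0) := by
    have h2 : Tendsto (fun y : EuclideanSpace ℝ (Fin n) => ‖y‖) (𝓝 0) (𝓝 0) := by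
      simpa using (continuous_norm (E := EuclideanSpace ℝ (Fin n))).tendsto 0
    simpa using (hG.tendsto.comp h2).sub_const (G 0)
  have h3 := ((Asymptotics.isLittleO_one_iff ℝ).2 h1).smul_isBigO
    (Asymptotics.isBigO_refl (fun y : EuclideanSpace ℝ (Fin n) => y) (𝓝 0))
  simpa [sub_smul] using h3

lemma divergence_radial_field_zero {G : ℝ → ℝ} (hG : ContinuousAt G 0) :
    divergence (fun y : EuclideanSpace ℝ (Fin n) => G ‖y‖ • y) 0 = n * G 0 := by
  rw [divergence, (hasFDerivAt_radial_field_zero hG).fderiv]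
  simp

lemma hasGradientAt_radial_zero {f : ℝ → ℝ} {φ : ℝ → ℝ} (hφ : ContinuousAt φ 0) (hφ0 : φ 0 = 0)
    (hf : ∀ r, 0 ≤ r → |f r - f 0| ≤ r * φ r) :
    HasGradientAt (fun y : EuclideanSpace ℝ (Fin n) => f ‖y‖) 0 0 := by
  rw [hasGradientAt_iff_hasFDerivAt, hasFDerivAt_iff_isLittleO_nhds_zero]
  have h1 : Tendsto (fun y : EuclideanSpace ℝ (Fin n) => φ ‖y‖) (𝓝 0) (𝓝 0) := by
    have h2 : Tendsto (fun y : EuclideanSpace ℝ (Fin n) => ‖y‖) (𝓝 0) (𝓝 0) := by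
      simpa using (continuous_norm (E := EuclideanSpace ℝ (Fin n))).tendsto 0
    rw [← hφ0]
    exact hφ.tendsto.comp h2
  have h3 := (Asymptotics.isBigO_refl (fun y : EuclideanSpace ℝ (Fin n) => ‖y‖)
    (𝓝 0)).mul_isLittleO ((Asymptotics.isLittleO_one_iff ℝ).2 h1)
  simp only [mul_one] at h3
  refine Asymptotics.IsLittleO.of_norm_right (Asymptotics.IsBigO.trans_isLittleO
    (Asymptotics.IsBigO.of_bound 1 (Eventually.of_forall fun y => ?_)) h3)
  have := hf ‖y‖ (norm_nonneg _)
  simp only [zero_add, norm_zero, map_zero, zero_apply, sub_zero, one_mul]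
  rw [Real.norm_eq_abs]
  exact this.trans (le_abs_self _)

end Radial

/-! ### From shots to radial solutions -/

section ToPDE

variable {n : ℕ} {p m q γ a : ℝ} {K u : ℝ → ℝ}

/-- The map `v ↦ ‖v‖^(p-2) v` undoes the power `m`, since `m (p - 2) + m = 1`. -/
lemma rpow_norm_smul_slope {g : ℝ} {x : EuclideanSpace ℝ (Fin n)} (hm : 1 ≤ m)
    (hpm : m * (p - 1) = 1) (hg : 0 ≤ g) (hx : x ≠ 0) :
    ‖(-(‖x‖ * g) ^ m / ‖x‖) • x‖ ^ (p - 2) • ((-(‖x‖ * g) ^ m / ‖x‖) • x) = (-g) • x := by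
  have hx' : 0 < ‖x‖ := norm_pos_iff.2 hx
  rcases hg.eq_or_lt with rfl | hg
  · simp [Real.zero_rpow (show m ≠ 0 by linarith)]
  have hy : 0 < ‖x‖ * g := by positivity
  have h1 : ‖(-(‖x‖ * g) ^ m / ‖x‖) • x‖ = (‖x‖ * g) ^ m := by
    rw [norm_smul, norm_div, norm_neg, norm_norm, Real.norm_of_nonneg (by positivity)]
    field_simp
  rw [h1, smul_smul, ← Real.rpow_mul hy.le]
  congr 1
  have h2 : (‖x‖ * g) ^ (m * (p - 2)) * (‖x‖ * g) ^ m = ‖x‖ * g := by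
    rw [← Real.rpow_add hy]
    rw [show m * (p - 2) + m = 1 by linear_combination hpm, Real.rpow_one]
  field_simp
  linear_combination -h2

namespace IsShot

lemma hasGradientAt (hu : IsShot n m q K a u) (h : ShootingData n m q γ K)
    (x : EuclideanSpace ℝ (Fin n)) :
    HasGradientAt (fun y : EuclideanSpace ℝ (Fin n) => u ‖y‖)
      ((-(‖x‖ * fluxAvg n q K u ‖x‖) ^ m / ‖x‖) • x) x := by
  rcases eq_or_ne x 0 with rfl | hx
  · rw [smul_zero]
    have hm := h.one_le_m
    refine hasGradientAt_radial_zero (φ := fun r => (r * (K r * a ^ (q - 1))) ^ m) ?_ ?_ ?_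
    · have := h.cont
      exact ((by fun_prop : Continuous fun r => r * (K r * a ^ (q - 1))).rpow_const
        fun _ => Or.inr (by linarith)).continuousAt
    · simp [Real.zero_rpow (show m ≠ 0 by linarith)]
    · intro r hr
      have h1 := hu.init_sub_le h hr
      have h2 := hu.le_init h hr
      rw [hu.apply_zero, abs_sub_comm, abs_of_nonneg (by linarith)]
      linarith
  · exact hasGradientAt_radial hx (hu.hasDerivAt h (norm_pos_iff.2 hx))

lemma pFlux_eq (hu : IsShot n m q K a u) (h : ShootingData n m q γ K) (hpm : m * (p - 1) = 1) :
    pFlux p (fun y : EuclideanSpace ℝ (Fin n) => u ‖y‖) =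
      fun x => (-fluxAvg n q K u ‖x‖) • x := by
  ext1 x
  rw [pFlux, (hu.hasGradientAt h x).gradient]
  rcases eq_or_ne x 0 with rfl | hx
  · simp
  · exact rpow_norm_smul_slope h.one_le_m hpm (h.fluxAvg_nonneg u (norm_nonneg x)) hx

/-- Written as `-‖x‖^(m-1) G^m x`, the gradient has no singularity at the origin because `m ≥ 1`. -/
lemma contDiff_radial (hu : IsShot n m q K a u) (h : ShootingData n m q γ K) :
    ContDiff ℝ 1 (fun y : EuclideanSpace ℝ (Fin n) => u ‖y‖) := by
  have hm := h.one_le_m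
  rw [contDiff_one_iff_fderiv]
  refine ⟨fun x => (hu.hasGradientAt h x).hasFDerivAt.differentiableAt, ?_⟩
  have hfd : fderiv ℝ (fun y : EuclideanSpace ℝ (Fin n) => u ‖y‖) = fun x =>
      InnerProductSpace.toDual ℝ _
        (-(‖x‖ ^ (m - 1) * fluxAvg n q K u ‖x‖ ^ m) • x) := by
    ext1 x
    rw [(hu.hasGradientAt h x).hasFDerivAt.fderiv]
    congr 1
    rcases eq_or_ne x 0 with rfl | hx
    · simp
    · have hx' := norm_pos_iff.2 hx
      rw [Real.mul_rpow hx'.le (h.fluxAvg_nonneg u hx'.le), Real.rpow_sub_one hx'.ne']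
      congr 1
      ring
  rw [hfd]
  refine (InnerProductSpace.toDual ℝ (EuclideanSpace ℝ (Fin n))).continuous.comp ?_
  have h1 : Continuous fun x : EuclideanSpace ℝ (Fin n) => ‖x‖ ^ (m - 1) :=
    continuous_norm.rpow_const fun _ => Or.inr (by linarith)
  have h2 : Continuous fun x : EuclideanSpace ℝ (Fin n) => fluxAvg n q K u ‖x‖ ^ m :=
    ((h.continuous_fluxAvg hu.cont).comp continuous_norm).rpow_const
      fun _ => Or.inr (by linarith)
  fun_prop

end IsShot

lemma IsShotZero.exists_isRadialSolution {R : ℝ} {K₀ : ℝ → ℝ}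
    (hz : IsShotZero n m q K a R) (h : ShootingData n m q γ K) (hpm : m * (p - 1) = 1)
    (hq : q = sobolevExponent n p) (hK : ∀ r, 0 ≤ r → K₀ r = K r) :
    ∃ U : EuclideanSpace ℝ (Fin n) → ℝ, IsRadialSolution n p K₀ R U ∧ U 0 = a := by
  obtain ⟨u, hu, hR, hzero, hpos⟩ := hz
  have hpos' : ∀ x ∈ Metric.ball (0 : EuclideanSpace ℝ (Fin n)) R, 0 < u ‖x‖ := fun x hx =>
    hpos ‖x‖ ⟨norm_nonneg x, by simpa using hx⟩
  have hG : Continuous fun r => -fluxAvg n q K u r := (h.continuous_fluxAvg hu.cont).neg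
  refine ⟨fun x => u ‖x‖, ⟨fun x _ y _ hxy => by simp only [hxy],
    (hu.cont.comp continuous_norm).continuousOn, (hu.contDiff_radial h).contDiffOn, ?_, ?_,
    hpos', ?_⟩, by simp [hu.apply_zero]⟩
  · intro x _
    rw [hu.pFlux_eq h hpm]
    rcases eq_or_ne x 0 with rfl | hx
    · exact (hasFDerivAt_radial_field_zero
        hG.continuousAt).differentiableAt.differentiableWithinAt
    · exact (hasFDerivAt_radial_field hx (hu.hasDerivAt_fluxAvg h
        (norm_pos_iff.2 hx)).neg).differentiableAt.differentiableWithinAt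
  · intro x hxR
    have hux := hpos' x hxR
    have e1 : u ‖x‖ * |u ‖x‖| ^ (sobolevExponent n p - 2) = u ‖x‖ ^ (q - 1) := by
      rw [abs_of_pos hux, ← hq, ← Real.rpow_one_add' hux.le (by linarith [h.two_le_q])]
      congr 1; ring
    simp only [pLaplacian]
    rw [e1, hu.pFlux_eq h hpm, hK _ (norm_nonneg x)]
    rcases eq_or_ne x 0 with rfl | hx
    · rw [divergence_radial_field_zero hG.continuousAt, hu.fluxAvg_zero h, norm_zero,
        hu.apply_zero]
      have : (n : ℝ) ≠ 0 := by exact_mod_cast h.n_pos.ne'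
      field_simp
      ring
    · have hx' := norm_pos_iff.2 hx
      rw [divergence_radial_field (G := fun r => -fluxAvg n q K u r) hx
        (hu.hasDerivAt_fluxAvg h hx').neg, max_eq_left hux.le]
      field_simp
      ring
  · intro x hx
    have : ‖x‖ = R := by simpa using hx
    simp only [this, hzero]

end ToPDE

/-! ### From radial solutions to shots -/

lemma eqOn_of_hasDerivAt_eq {D : Set ℝ} (hD : Convex ℝ D) {f g f' : ℝ → ℝ} {x₀ : ℝ}
    (hf : ContinuousOn f D) (hg : ContinuousOn g D)
    (hf' : ∀ x ∈ interior D, HasDerivAt f (f' x) x) (hg' : ∀ x ∈ interior D, HasDerivAt g (f' x) x)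
    (hx₀ : x₀ ∈ D) (h0 : f x₀ = g x₀) : EqOn f g D := by
  have hd : ∀ x ∈ interior D, HasDerivWithinAt (fun x => f x - g x) 0 (interior D) x := fun x hx =>
    (((hf' x hx).sub (hg' x hx)).congr_deriv (sub_self _)).hasDerivWithinAt
  have h1 := monotoneOn_of_hasDerivWithinAt_nonneg hD (hf.sub hg) hd fun _ _ => le_rfl
  have h2 := antitoneOn_of_hasDerivWithinAt_nonpos hD (hf.sub hg) hd fun _ _ => le_rfl
  intro x hx
  have : f x - g x = f x₀ - g x₀ := by
    rcases le_total x x₀ with h | h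
    · exact le_antisymm (h1 hx hx₀ h) (h2 hx hx₀ h)
    · exact le_antisymm (h2 hx₀ hx h) (h1 hx₀ hx h)
  linarith

/-- Recovers the slope from the scalar flux `|z|^(p-2) z`; the sign of the flux determines that of
`z`. -/
lemma eq_neg_rpow_of_rpow_abs_mul {p m y z : ℝ} (hp : 1 < p) (hpm : m * (p - 1) = 1) (hy : 0 ≤ y)
    (hz : |z| ^ (p - 2) * z = -y) : z = -y ^ m := by
  have hm : 0 < m := by
    by_contra hcon
    nlinarith
  rcases eq_or_ne z 0 with rfl | hz0
  · rw [mul_zero, zero_eq_neg] at hz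
    rw [hz, Real.zero_rpow hm.ne', neg_zero]
  have h1 : 0 < |z| ^ (p - 2) := Real.rpow_pos_of_pos (abs_pos.2 hz0) _
  have hneg : z < 0 := by
    rcases lt_or_gt_of_ne hz0 with h | h
    · exact h
    · have := mul_pos h1 h
      linarith
  have h2 : y = |z| ^ (p - 1) := by
    have e : |z| ^ (p - 1) = |z| ^ (p - 2) * |z| := by
      rw [← Real.rpow_add_one (abs_pos.2 hz0).ne']; congr 1; ring
    rw [e, abs_of_neg hneg] at *
    linarith
  rw [h2, ← Real.rpow_mul (abs_nonneg z), mul_comm, hpm, Real.rpow_one, abs_of_neg hneg, neg_neg]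

section FromPDE

variable {n : ℕ} {p m q γ : ℝ} {K K₀ : ℝ → ℝ} {R : ℝ} {U : EuclideanSpace ℝ (Fin n) → ℝ}

/-- Restricted to a ray, the equation becomes an ODE for the scalar flux `F`. Two integrations give
the integrated shooting equation, and uniqueness identifies the profile with the shot. -/
lemma IsRadialSolution.isShotZero (hU : IsRadialSolution n p K₀ R U) (hR : 0 < R) (hn : 2 ≤ n)
    (hp : 1 < p) (h : ShootingData n m q γ K) (hpm : m * (p - 1) = 1)
    (hq : q = sobolevExponent n p) (hK : ∀ r, 0 ≤ r → K₀ r = K r) :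
    IsShotZero n m q K (U 0) R := by
  set i₀ : Fin n := ⟨0, by omega⟩
  set e : EuclideanSpace ℝ (Fin n) := EuclideanSpace.single i₀ 1 with he
  have hen : ‖e‖ = 1 := by simp [he]
  have hnorm : ∀ r : ℝ, 0 ≤ r → ‖r • e‖ = r := fun r hr => by
    rw [norm_smul, hen, mul_one, Real.norm_of_nonneg hr]
  have hne : ∀ r : ℝ, 0 < r → r • e ≠ 0 := fun r hr => by
    rw [← norm_pos_iff, hnorm r hr.le]; exact hr
  have hball : ∀ r ∈ Ico 0 R, r • e ∈ Metric.ball (0 : EuclideanSpace ℝ (Fin n)) R := fun r hr => by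
    simpa [hnorm r hr.1] using hr.2
  have hcball : ∀ r ∈ Icc 0 R, r • e ∈ Metric.closedBall (0 : EuclideanSpace ℝ (Fin n)) R :=
    fun r hr => by simpa [hnorm r hr.1] using hr.2
  have hline : ∀ r : ℝ, HasDerivAt (fun t : ℝ => t • e) e r := fun r => by
    simpa using (hasDerivAt_id r).smul_const e
  set f : ℝ → ℝ := fun r => U (r • e) with hf
  have hUf : ∀ x ∈ Metric.closedBall (0 : EuclideanSpace ℝ (Fin n)) R, U x = f ‖x‖ := by
    intro x hx
    have hx' : ‖x‖ ≤ R := by simpa using hx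
    exact hU.radial x hx _ (hcball _ ⟨norm_nonneg x, hx'⟩) (hnorm _ (norm_nonneg x)).symm
  have hfcont : ContinuousOn f (Icc 0 R) :=
    hU.continuousOn.comp (by fun_prop) fun r hr => hcball r hr
  have hfd : ∀ r ∈ Ioo 0 R, HasDerivAt f (deriv f r) r := by
    intro r hr
    have h1 : DifferentiableAt ℝ U (r • e) :=
      (hU.contDiffOn.differentiableOn one_ne_zero).differentiableAt
        (Metric.isOpen_ball.mem_nhds (hball r ⟨hr.1.le, hr.2⟩))
    exact (h1.hasFDerivAt.comp_hasDerivAt r (hline r)).differentiableAt.hasDerivAt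
  -- the flux is a radial field
  set F : ℝ → ℝ := fun r => pFlux p U (r • e) i₀ with hF
  have hflux : ∀ x ∈ Metric.ball (0 : EuclideanSpace ℝ (Fin n)) R, x ≠ 0 →
      pFlux p U x = (|deriv f ‖x‖| ^ (p - 2) * deriv f ‖x‖ / ‖x‖) • x := by
    intro x hx hx0
    have hx' : ‖x‖ < R := by simpa using hx
    have hxp := norm_pos_iff.2 hx0
    have h1 : HasGradientAt U ((deriv f ‖x‖ / ‖x‖) • x) x := by
      have h2 := (hasGradientAt_radial hx0 (hfd ‖x‖ ⟨hxp, hx'⟩)).hasFDerivAt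
      rw [hasGradientAt_iff_hasFDerivAt]
      refine h2.congr_of_eventuallyEq ?_
      filter_upwards [Metric.isOpen_ball.mem_nhds hx] with y hy
      exact hUf y (Metric.ball_subset_closedBall hy)
    rw [pFlux, h1.gradient, norm_smul, norm_div, norm_norm, div_mul_cancel₀ _ hxp.ne',
      Real.norm_eq_abs, smul_smul]
    congr 1
    ring
  have hFeq : ∀ r ∈ Ioo 0 R, F r = |deriv f r| ^ (p - 2) * deriv f r := by
    intro r hr
    rw [hF]
    simp only
    rw [hflux _ (hball r ⟨hr.1.le, hr.2⟩) (hne r hr.1), hnorm r hr.1.le]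
    have := hr.1.ne'
    simp [he]
    field_simp
  have hfluxF : ∀ x ∈ Metric.ball (0 : EuclideanSpace ℝ (Fin n)) R, x ≠ 0 →
      pFlux p U x = (F ‖x‖ / ‖x‖) • x := by
    intro x hx hx0
    rw [hflux x hx hx0, hFeq ‖x‖ ⟨norm_pos_iff.2 hx0, by simpa using hx⟩]
  have hFd : ∀ r ∈ Ico 0 R, DifferentiableAt ℝ F r := by
    intro r hr
    have h1 : DifferentiableAt ℝ (pFlux p U) (r • e) :=
      hU.differentiableOn_flux.differentiableAt (Metric.isOpen_ball.mem_nhds (hball r hr))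
    have h2 := (h1.hasFDerivAt.comp_hasDerivAt r (hline r)).differentiableAt
    exact ((EuclideanSpace.proj (𝕜 := ℝ) i₀).differentiableAt).comp r h2
  have hfpos : ∀ r ∈ Ico 0 R, 0 < f r := fun r hr => hU.pos _ (hball r hr)
  have hODE : ∀ r ∈ Ioo 0 R,
      HasDerivAt (fun r => r ^ (n - 1) * F r) (-(r ^ (n - 1) * (K r * f r ^ (q - 1)))) r := by
    intro r hr
    have hr0 := hr.1
    have hx0 := hne r hr0
    have hx := hball r ⟨hr0.le, hr.2⟩
    have hFr := (hFd r ⟨hr0.le, hr.2⟩).hasDerivAt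
    have hG : HasDerivAt (fun r => F r / r) ((deriv F r * r - F r * 1) / r ^ 2) ‖r • e‖ := by
      rw [hnorm r hr0.le]
      exact hFr.div (hasDerivAt_id r) hr0.ne'
    have hdiv := divergence_radial_field hx0 hG
    have hdiv' : divergence (pFlux p U) (r • e) =
        divergence (fun y : EuclideanSpace ℝ (Fin n) => (F ‖y‖ / ‖y‖) • y) (r • e) := by
      have : pFlux p U =ᶠ[𝓝 (r • e)] fun y => (F ‖y‖ / ‖y‖) • y := by
        filter_upwards [Metric.isOpen_ball.mem_nhds hx, isOpen_ne.mem_nhds hx0] with y hy hy0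
        exact hfluxF y hy hy0
      rw [divergence, divergence, this.fderiv_eq]
    have heq := hU.equation _ hx
    have hur := hfpos r ⟨hr0.le, hr.2⟩
    have e1 : f r * |f r| ^ (sobolevExponent n p - 2) = f r ^ (q - 1) := by
      rw [abs_of_pos hur, ← hq, ← Real.rpow_one_add' hur.le (by linarith [h.two_le_q])]
      congr 1; ring
    rw [pLaplacian, hdiv', hdiv, hnorm r hr0.le, hK r hr0.le, e1] at heq
    refine ((hasDerivAt_pow (n - 1) r).mul hFr).congr_deriv ?_
    obtain ⟨k, rfl⟩ : ∃ k, n = k + 2 := ⟨n - 2, by omega⟩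
    simp only [show k + 2 - 1 = k + 1 by omega, Nat.add_sub_cancel] at heq ⊢
    push_cast at heq ⊢
    field_simp at heq
    linear_combination r ^ k * heq
  -- a continuous extension of the profile to the whole line
  set w : ℝ → ℝ := fun r => f (max 0 (min r R)) with hw
  have hwf : ∀ r ∈ Icc 0 R, w r = f r := fun r hr => by
    rw [hw]; simp only; rw [min_eq_left hr.2, max_eq_right hr.1]
  have hwcont : Continuous w :=
    hfcont.comp_continuous (by fun_prop) fun r =>
      ⟨le_max_left _ _, max_le hR.le (min_le_right _ _)⟩
  -- Both sides have the same derivative and vanish at `0`, the right one because `n ≥ 2`. The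
  -- endpoint `R` is left out since the flux is controlled only in the open ball.
  have hfl : ∀ r ∈ Ico 0 R, r ^ n * fluxAvg n q K w r = -(r ^ (n - 1) * F r) := by
    refine eqOn_of_hasDerivAt_eq (convex_Ico 0 R)
      (f' := fun r => r ^ (n - 1) * (K r * f r ^ (q - 1))) (x₀ := 0) ?_ ?_ ?_ ?_ ⟨le_rfl, hR⟩ ?_
    · have := h.continuous_fluxAvg hwcont
      fun_prop
    · exact ((continuous_pow (n - 1)).continuousOn.mul fun r hr =>
        (hFd r hr).continuousAt.continuousWithinAt).neg
    · intro r hr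
      rw [interior_Ico] at hr
      have h1 := hasDerivAt_pow_mul_ballAvg h.n_pos (h.continuous_source hwcont) r
      rwa [hwf r ⟨hr.1.le, hr.2.le⟩, max_eq_left (hfpos r ⟨hr.1.le, hr.2⟩).le] at h1
    · intro r hr
      rw [interior_Ico] at hr
      exact (hODE r hr).neg.congr_deriv (neg_neg _)
    · simp [show n ≠ 0 by omega, show n - 1 ≠ 0 by omega]
  have hfderiv : ∀ r ∈ Ioo 0 R, HasDerivAt f (-(r * fluxAvg n q K w r) ^ m) r := by
    intro r hr
    have hr0 := hr.1
    have h1 := hfl r ⟨hr.1.le, hr.2⟩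
    have h2 : F r = -(r * fluxAvg n q K w r) := by
      have e1 : r ^ n = r ^ (n - 1) * r := by rw [← pow_succ, Nat.sub_add_cancel h.n_pos]
      rw [e1] at h1
      have h3 : 0 < r ^ (n - 1) := by positivity
      refine mul_left_cancel₀ h3.ne' ?_
      linarith
    rw [← eq_neg_rpow_of_rpow_abs_mul hp hpm
      (mul_nonneg hr0.le (h.fluxAvg_nonneg w hr0.le)) ((hFeq r hr).symm.trans h2)]
    exact hfd r hr
  have ha : 0 < U 0 := hU.pos 0 (by simpa using hR)
  have hf0 : f 0 = U 0 := by simp [hf]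
  have hc := h.continuous_slope hwcont
  have hwe : ∀ r ∈ Icc 0 R, w r = U 0 - ∫ x in (0 : ℝ)..r, (x * fluxAvg n q K w x) ^ m := by
    have h1 : EqOn f (fun r => U 0 - ∫ x in (0 : ℝ)..r, (x * fluxAvg n q K w x) ^ m)
        (Icc 0 R) := by
      have hI : ∀ r, HasDerivAt (fun r => U 0 - ∫ x in (0 : ℝ)..r, (x * fluxAvg n q K w x) ^ m)
          (-(r * fluxAvg n q K w r) ^ m) r := fun r =>
        (intervalIntegral.integral_hasDerivAt_right (hc.intervalIntegrable 0 r)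
          (hc.stronglyMeasurableAtFilter _ _) hc.continuousAt).const_sub (U 0)
      refine eqOn_of_hasDerivAt_eq (convex_Icc 0 R) (x₀ := 0) hfcont
        (fun r _ => (hI r).continuousAt.continuousWithinAt) ?_ (fun r _ => hI r)
        ⟨le_rfl, hR.le⟩ (by simp [hf0])
      intro r hr
      rw [interior_Icc] at hr
      exact hfderiv r hr
    intro r hr
    rw [hwf r hr]
    exact h1 hr
  obtain ⟨u, hu⟩ := h.exists_isShot ha
  have huw := h.eqOn hu hR.le hwcont hwe
  refine ⟨u, hu, hR, ?_, fun t ht => ?_⟩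
  · rw [huw ⟨hR.le, le_rfl⟩, hwf R ⟨hR.le, le_rfl⟩]
    exact hU.boundary _ (by simp [hnorm R hR.le])
  · rw [huw ⟨ht.1, ht.2.le⟩, hwf t ⟨ht.1, ht.2.le⟩]
    exact hfpos t ht

end FromPDE

/-! ### The zero map as a function of the logarithm of the initial value -/

section ZeroMap

variable {n : ℕ} {m q γ : ℝ} {K : ℝ → ℝ}

/-- In logarithmic scale the first zero is continuous and tends to infinity for small data. -/
lemma ShootingData.exists_log_zero_map (h : ShootingData n m q γ K)
    (hstrict : ∃ x y, 0 ≤ x ∧ x < y ∧ K x < K y) :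
    ∃ σ : ℝ → ℝ, Continuous σ ∧ (∀ t R, IsShotZero n m q K (Real.exp t) R ↔ R = σ t) ∧
      Tendsto σ atBot atTop := by
  obtain ⟨ρ, hρ, hρc⟩ := h.exists_zero_map hstrict
  refine ⟨fun t => ρ (Real.exp t), ?_, fun t R => hρ _ R (Real.exp_pos t), ?_⟩
  · exact hρc.comp_continuous Real.continuous_exp fun t => Real.exp_pos t
  · have hm := h.one_le_m
    have hγ := h.γ_pos
    rw [tendsto_atTop]
    intro M₀
    set M := max M₀ 1
    have hM : 0 < M := lt_of_lt_of_le one_pos (le_max_right _ _)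
    have hlim : Tendsto (fun t : ℝ => M ^ (1 + m) * K M ^ m * Real.exp t ^ (γ * (1 + m))) atBot
        (𝓝 (M ^ (1 + m) * K M ^ m * 0 ^ (γ * (1 + m)))) :=
      (Real.tendsto_exp_atBot.rpow_const (Or.inr (by positivity))).const_mul _
    rw [Real.zero_rpow (by positivity), mul_zero] at hlim
    filter_upwards [hlim.eventually (gt_mem_nhds one_pos)] with t ht
    refine (le_max_left M₀ 1).trans ?_
    by_contra hcon
    obtain ⟨u, hu, hR, hz, -⟩ := (hρ _ _ (Real.exp_pos t)).2 rfl
    have hle : ρ (Real.exp t) ≤ M := (not_le.1 hcon).le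
    have h1 := hu.one_le_of_zero h hR hle hz
    have hK := h.pos M
    have h2 : ρ (Real.exp t) ^ (1 + m) ≤ M ^ (1 + m) :=
      Real.rpow_le_rpow hR.le hle (by linarith)
    have h3 : ρ (Real.exp t) ^ (1 + m) * K M ^ m * Real.exp t ^ (γ * (1 + m))
      ≤ M ^ (1 + m) * K M ^ m * Real.exp t ^ (γ * (1 + m)) := by gcongr
    linarith

variable {l : ℝ} {σ : ℝ → ℝ}

lemma ShootingData.exists_log_zero_ge (h : ShootingData n m q γ K) (hl : 0 < l) (hln : l < n * m)
    (hKd : ∀ M : ℝ, 0 < M → ∃ C : ℝ, 0 < C ∧ ∀ r ∈ Ioc 0 M, r * deriv K r ≤ C * r ^ l)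
    (hσ : ∀ t R, IsShotZero n m q K (Real.exp t) R ↔ R = σ t) {M : ℝ} (hM : 0 < M) :
    ∃ c : ℝ, 0 < c ∧ ∀ t, σ t ≤ M →
      c * Real.exp t ^ (γ * l - (1 + m)) ≤ σ t ^ ((1 + m) / γ) := by
  obtain ⟨C, hC, hKC⟩ := hKd M hM
  obtain ⟨c, hc, hcz⟩ := h.exists_zero_ge hl hln hC hKC
  refine ⟨c, hc, fun t ht => ?_⟩
  obtain ⟨u, hu, hR, hz, hpos⟩ := (hσ t _).2 rfl
  exact hcz _ _ u hu hR ht hz hpos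

/-- At critical flatness the exponent of the central value in the lower bound vanishes, so zeros not
exceeding `1` have a uniform positive lower bound. -/
lemma ShootingData.log_zero_map_bounded_below (h : ShootingData n m q γ K)
    (hKd : ∀ M : ℝ, 0 < M → ∃ C : ℝ, 0 < C ∧
      ∀ r ∈ Ioc 0 M, r * deriv K r ≤ C * r ^ ((1 + m) / γ))
    (hσ : ∀ t R, IsShotZero n m q K (Real.exp t) R ↔ R = σ t) :
    ∃ c : ℝ, 0 < c ∧ ∀ t, c ≤ σ t := by
  have hm := h.one_le_m
  have hγ := h.γ_pos
  have hl := h.criticalRate_pos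
  obtain ⟨c, hc, hcz⟩ := h.exists_log_zero_ge hl (by rw [h.n_mul_m]; linarith) hKd hσ one_pos
  refine ⟨min 1 (c ^ ((1 + m) / γ)⁻¹), by positivity, fun t => ?_⟩
  rcases le_total (σ t) 1 with h1 | h1
  · have h2 := hcz t h1
    rw [mul_div_cancel₀ _ hγ.ne', sub_self, Real.rpow_zero, mul_one] at h2
    have hR : 0 < σ t := by
      obtain ⟨u, hu, hR, -⟩ := (hσ t _).2 rfl
      exact hR
    refine (min_le_right _ _).trans ?_
    rwa [Real.rpow_inv_le_iff_of_pos hc.le hR.le hl]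
  · exact (min_le_left _ _).trans h1

/-- Above critical flatness that exponent is positive, so the zeros cannot stay below any `M` for
large central values. -/
lemma ShootingData.log_zero_map_tendsto_atTop (h : ShootingData n m q γ K)
    (hl : (1 + m) / γ < l) (hln : l < n * m)
    (hKd : ∀ M : ℝ, 0 < M → ∃ C : ℝ, 0 < C ∧ ∀ r ∈ Ioc 0 M, r * deriv K r ≤ C * r ^ l)
    (hσ : ∀ t R, IsShotZero n m q K (Real.exp t) R ↔ R = σ t) :
    Tendsto σ atTop atTop := by
  have hm := h.one_le_m
  have hγ := h.γ_pos
  have hl₀ := h.criticalRate_pos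
  rw [tendsto_atTop]
  intro M₀
  set M := max M₀ 1
  have hM : 0 < M := lt_of_lt_of_le one_pos (le_max_right _ _)
  obtain ⟨c, hc, hcz⟩ := h.exists_log_zero_ge (hl₀.trans hl) hln hKd hσ hM
  have he : 0 < γ * l - (1 + m) := by
    rw [div_lt_iff₀ hγ] at hl; linarith
  have hlim : Tendsto (fun t : ℝ => c * Real.exp t ^ (γ * l - (1 + m))) atTop atTop :=
    ((tendsto_rpow_atTop he).comp Real.tendsto_exp_atTop).const_mul_atTop hc
  filter_upwards [hlim.eventually (eventually_gt_atTop (M ^ ((1 + m) / γ)))] with t ht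
  refine (le_max_left M₀ 1).trans ?_
  by_contra hcon
  have hle : σ t ≤ M := (not_le.1 hcon).le
  have h1 := hcz t hle
  have hR : 0 < σ t := by
    obtain ⟨u, hu, hR, -⟩ := (hσ t _).2 rfl
    exact hR
  have h2 : σ t ^ ((1 + m) / γ) ≤ M ^ ((1 + m) / γ) := Real.rpow_le_rpow hR.le hle hl₀.le
  linarith

end ZeroMap

/-! ### Consequences of the flatness condition -/

lemma ContDiffOn.differentiableAt_of_Ici {K : ℝ → ℝ} (hK : ContDiffOn ℝ 1 K (Ici 0)) {r : ℝ}
    (hr : 0 < r) : DifferentiableAt ℝ K r :=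
  (hK.differentiableOn one_ne_zero).differentiableAt (Ici_mem_nhds hr)

lemma FlatnessCondition.exists_deriv_le_near {K : ℝ → ℝ} {l : ℝ} (hl : FlatnessCondition K l)
    (hK : ContDiffOn ℝ 1 K (Ici 0)) :
    ∃ δ C : ℝ, 0 < δ ∧ 0 < C ∧ ∀ r ∈ Ioo 0 δ, r * deriv K r ≤ C * r ^ l := by
  obtain ⟨hl0, A, B, hA, hB, f, hf, hlim⟩ := hl
  obtain ⟨δ, hδ, hδ'⟩ := (mem_nhdsGT_iff_exists_Ioo_subset).1 (hlim.eventually (gt_mem_nhds one_pos))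
  -- `B l r^l` comes from the leading term, and near `0` the remainder `r h'` is at most `r^l`.
  refine ⟨δ, B * l + 1, hδ, by positivity, fun r hr => ?_⟩
  have hr0 := hr.1
  have h1 : (|f r| + r * |deriv f r|) / r ^ l < 1 := hδ' hr
  rw [div_lt_one (by positivity)] at h1
  have hKr := (hK.differentiableAt_of_Ici hr0).hasDerivAt
  have hfr : HasDerivAt f (deriv K r - B * (l * r ^ (l - 1))) r := by
    refine (hKr.sub ((Real.hasDerivAt_rpow_const (p := l)
      (Or.inl hr0.ne')).const_mul B)).sub_const A |>.congr_of_eventuallyEq ?_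
    filter_upwards [Ioi_mem_nhds hr0] with x hx
    have := hf x (le_of_lt hx)
    simp only [Pi.sub_apply]
    linarith
  have h2 := hfr.deriv
  have h3 : r * r ^ (l - 1) = r ^ l := by
    rw [Real.rpow_sub_one hr0.ne']; field_simp
  have h4 : r * deriv f r ≤ r * |deriv f r| := by gcongr; exact le_abs_self _
  have h5 := abs_nonneg (f r)
  rw [h2] at h4 h1
  have h6 : r * (deriv K r - B * (l * r ^ (l - 1))) = r * deriv K r - B * l * r ^ l := by
    rw [← h3]; ring
  linarith

/-- Away from `0` compactness bounds `r K'`. A smaller exponent `l'` is allowed so that the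
condition `l < n m` of the far estimate can always be met. -/
lemma FlatnessCondition.exists_deriv_le {K : ℝ → ℝ} {l l' : ℝ} (hl : FlatnessCondition K l)
    (hK : ContDiffOn ℝ 1 K (Ici 0)) (hl' : l' ≤ l) {M : ℝ} (hM : 0 < M) :
    ∃ C : ℝ, 0 < C ∧ ∀ r ∈ Ioc 0 M, r * deriv K r ≤ C * r ^ l' := by
  obtain ⟨δ, C₁, hδ, hC₁, hnear⟩ := hl.exists_deriv_le_near hK
  have hl0 := hl.1
  have hcont : ContinuousOn (fun r => r * deriv K r) (Icc δ M) := by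
    refine continuousOn_id.mul ?_
    have h1 : ContDiffOn ℝ 1 K (Ioi 0) := hK.mono Ioi_subset_Ici_self
    exact (h1.continuousOn_deriv_of_isOpen isOpen_Ioi le_rfl).mono fun x hx => hδ.trans_le hx.1
  obtain ⟨C₂, hC₂⟩ := isCompact_Icc.bddAbove_image hcont
  have hfar : ∀ r ∈ Icc δ M, r * deriv K r ≤ (|C₂| / δ ^ l) * r ^ l := by
    intro r hr
    have h1 : r * deriv K r ≤ C₂ := hC₂ ⟨r, hr, rfl⟩
    have h2 : δ ^ l ≤ r ^ l := Real.rpow_le_rpow hδ.le hr.1 hl0.le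
    have h3 : 0 < δ ^ l := by positivity
    calc _ ≤ |C₂| := h1.trans (le_abs_self _)
      _ = |C₂| / δ ^ l * δ ^ l := by field_simp
      _ ≤ _ := by gcongr
  refine ⟨(C₁ + |C₂| / δ ^ l) * M ^ (l - l'), by positivity, fun r hr => ?_⟩
  have hr0 := hr.1
  have h3 : 0 ≤ |C₂| / δ ^ l * r ^ l := by positivity
  have h4 : 0 ≤ C₁ * r ^ l := by positivity
  have h1 : r * deriv K r ≤ (C₁ + |C₂| / δ ^ l) * r ^ l := by
    rw [add_mul]
    rcases lt_or_ge r δ with h | h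
    · have := hnear r ⟨hr0, h⟩; linarith
    · have := hfar r ⟨h, hr.2⟩; linarith
  have h2 : r ^ l ≤ M ^ (l - l') * r ^ l' := by
    have e : r ^ l = r ^ (l - l') * r ^ l' := by rw [← Real.rpow_add hr0]; congr 1; ring
    rw [e]
    gcongr
    exact hr.2
  calc _ ≤ _ := h1
    _ ≤ (C₁ + |C₂| / δ ^ l) * (M ^ (l - l') * r ^ l') := by gcongr
    _ = _ := by ring

/-- The shooting data of the boundary value problem, with `K` extended by `K 0` to the left. -/
lemma shootingData_of_increasing {n : ℕ} {p : ℝ} {K : ℝ → ℝ} (hp1 : 1 < p) (hpn : p < n)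
    (hp_lower : 2 * (n : ℝ) / (2 + n) ≤ p) (hp_upper : p ≤ 2) (hK_pos : ∀ r, 0 ≤ r → 0 < K r)
    (hK_smooth : ContDiffOn ℝ 1 K (Ici 0)) (hK_mono : MonotoneOn K (Ici 0)) :
    ShootingData n (p - 1)⁻¹ (sobolevExponent n p) (p / (n - p)) fun r => K (max r 0) := by
  have hn0 : (0 : ℝ) < n := by linarith
  have hnp : 0 < (n : ℝ) - p := by linarith
  have hp0 : 0 < p - 1 := by linarith
  refine ⟨by exact_mod_cast hn0, ?_, ?_, by positivity, ?_, ?_, ?_, fun r => hK_pos _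
    (le_max_right _ _), ?_, ?_⟩
  -- Here `p ≤ 2` gives `m ≥ 1`; the lower bound on `p` next gives `q ≥ 2`.
  · rw [one_le_inv₀ hp0]; linarith
  · rw [sobolevExponent, le_div_iff₀ hnp]
    rw [div_le_iff₀ (by linarith)] at hp_lower
    linarith
  · rw [sobolevExponent]; ring
  · rw [sobolevExponent]; field_simp; ring
  · exact hK_smooth.continuousOn.comp_continuous (by fun_prop) fun r => mem_Ici.2 (le_max_right _ _)
  · intro x y hxy
    exact hK_mono (mem_Ici.2 (le_max_right _ _)) (mem_Ici.2 (le_max_right _ _)) (max_le_max_right 0 hxy)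
  · intro r hr
    refine (hK_smooth.differentiableAt_of_Ici hr).congr_of_eventuallyEq ?_
    filter_upwards [Ioi_mem_nhds hr] with x hx
    rw [max_eq_left (le_of_lt hx)]

lemma criticalFlatness_eq {n : ℕ} {p : ℝ} (hp1 : 1 < p) (hpn : p < n) :
    criticalFlatness n p = (1 + (p - 1)⁻¹) / (p / (n - p)) := by
  have hnp : (n : ℝ) - p ≠ 0 := by linarith
  have hp0 : p - 1 ≠ 0 := by linarith
  rw [criticalFlatness]
  field_simp
  ring

end

/-! ### The main theorem -/

theorem theorem2 (n : ℕ) (p : ℝ) (hp1 : 1 < p) (hpn : p < n)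
    (hp_lower : 2 * (n : ℝ) / (2 + n) ≤ p) (hp_upper : p ≤ 2)
    (K : ℝ → ℝ) (hK_pos : ∀ r, 0 ≤ r → 0 < K r) (hK_smooth : ContDiffOn ℝ 1 K (Set.Ici 0))
    (l : ℝ) (hl : FlatnessCondition K l) (hK_incr : IncreasingCondition K) :
    (l = criticalFlatness n p →
      ∃ R₀ : ℝ, 0 < R₀ ∧
        (∀ R, 0 < R → R < R₀ → ¬ ∃ u, IsRadialSolution n p K R u) ∧
        (∀ R, R₀ < R → ∃ u, IsRadialSolution n p K R u)) ∧
    (criticalFlatness n p < l →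
      ∃ R₀ : ℝ, 0 < R₀ ∧
        (∀ R, 0 < R → R < R₀ → ¬ ∃ u, IsRadialSolution n p K R u) ∧
        (∃ u, IsRadialSolution n p K R₀ u) ∧
        (∀ R, R₀ < R → ∃ u₁ u₂, IsRadialSolution n p K R u₁ ∧ IsRadialSolution n p K R u₂ ∧
          ∃ x ∈ Metric.closedBall (0 : EuclideanSpace ℝ (Fin n)) R, u₁ x ≠ u₂ x)) := by
  obtain ⟨hmono, x, y, hx, hxy, hstrict⟩ := hK_incr
  have h := shootingData_of_increasing hp1 hpn hp_lower hp_upper hK_pos hK_smooth hmono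
  have hpm : (p - 1)⁻¹ * (p - 1) = 1 := inv_mul_cancel₀ (by linarith)
  have hn2 : 2 ≤ n := by
    have : (1 : ℝ) < n := hp1.trans hpn
    exact_mod_cast this
  have hKeq : ∀ r, 0 ≤ r → K r = K (max r 0) := fun r hr => by rw [max_eq_left hr]
  have hcrit := criticalFlatness_eq hp1 hpn
  obtain ⟨σ, hσc, hσ, hσbot⟩ := h.exists_log_zero_map ⟨x, y, hx, hxy, by
    rw [max_eq_left hx, max_eq_left (hx.trans hxy.le)]
    exact hstrict ⟨le_rfl, hxy.le⟩ ⟨hxy.le, le_rfl⟩ hxy⟩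
  have hσpos : ∀ t, 0 < σ t := fun t => by
    obtain ⟨u, hu, hR, -⟩ := (hσ t _).2 rfl
    exact hR
  have hsol : ∀ t, ∃ u : EuclideanSpace ℝ (Fin n) → ℝ,
      IsRadialSolution n p K (σ t) u ∧ u 0 = Real.exp t := fun t =>
    ((hσ t _).2 rfl).exists_isRadialSolution h hpm rfl hKeq
  have hrad : ∀ R, 0 < R → (∃ u, IsRadialSolution n p K R u) → ∃ t, R = σ t := by
    rintro R hR ⟨u, hu⟩
    have h0 : 0 < u 0 := hu.pos 0 (by simpa using hR)
    refine ⟨Real.log (u 0), (hσ _ _).1 ?_⟩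
    rw [Real.exp_log h0]
    exact hu.isShotZero hR hn2 hp1 h hpm rfl hKeq
  have hKd : ∀ l', l' ≤ l → ∀ M : ℝ, 0 < M → ∃ C : ℝ, 0 < C ∧
      ∀ r ∈ Ioc 0 M, r * deriv (fun r => K (max r 0)) r ≤ C * r ^ l' := by
    intro l' hl' M hM
    obtain ⟨C, hC, hCK⟩ := hl.exists_deriv_le hK_smooth hl' hM
    refine ⟨C, hC, fun r hr => ?_⟩
    have : (fun r => K (max r 0)) =ᶠ[𝓝 r] K := by
      filter_upwards [Ioi_mem_nhds hr.1] with z hz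
      rw [max_eq_left (le_of_lt hz)]
    rw [this.deriv_eq]
    exact hCK r hr
  -- Intermediate values between `t₀` and `-∞`, where `σ` tends to infinity.
  have hleft : ∀ t₀ R, σ t₀ < R → ∃ t < t₀, σ t = R := by
    intro t₀ R hR
    obtain ⟨s, hs1, hs2⟩ := ((hσbot.eventually (eventually_ge_atTop R)).and
      (eventually_le_atBot t₀)).exists
    obtain ⟨t, ht, hte⟩ := intermediate_value_Icc' hs2 hσc.continuousOn ⟨hR.le, hs1⟩
    refine ⟨t, lt_of_le_of_ne ht.2 ?_, hte⟩
    rintro rfl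
    exact hR.ne hte
  constructor
  · intro hlc
    obtain ⟨c, hc, hcσ⟩ := h.log_zero_map_bounded_below
      (hKd _ (by rw [hlc, hcrit])) hσ
    have hbdd : BddBelow (range σ) := ⟨c, by rintro _ ⟨t, rfl⟩; exact hcσ t⟩
    -- The infimum need not be attained, which is why nothing is asserted at `R₀` itself.
    refine ⟨sInf (range σ), hc.trans_le (le_csInf (range_nonempty σ)
      (by rintro _ ⟨t, rfl⟩; exact hcσ t)), fun R hR hlt hex => ?_, fun R hR => ?_⟩
    · obtain ⟨t, rfl⟩ := hrad R hR hex
      exact absurd (csInf_le hbdd ⟨t, rfl⟩) (not_le.2 hlt)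
    · obtain ⟨_, ⟨t₀, rfl⟩, ht₀⟩ := exists_lt_of_csInf_lt (range_nonempty σ) hR
      obtain ⟨t, -, rfl⟩ := hleft t₀ R ht₀
      obtain ⟨u, hu, -⟩ := hsol t
      exact ⟨u, hu⟩
  · intro hlc
    rw [hcrit] at hlc
    have hnm := h.n_mul_m
    have hm := h.one_le_m
    set m := (p - 1)⁻¹
    set k := (1 + m) / (p / (n - p)) with hk
    have hσtop : Tendsto σ atTop atTop := by
      -- The exponent is lowered to lie strictly between `k` and `n m = k + (1 + m)`.
      refine h.log_zero_map_tendsto_atTop (l := min l (k + 1 / 2)) (lt_min hlc (by linarith)) ?_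
        (hKd _ (min_le_left _ _)) hσ
      refine (min_le_right _ _).trans_lt ?_
      linarith
    obtain ⟨t₀, ht₀⟩ := hσc.exists_forall_le (by
      rw [cocompact_eq_atBot_atTop]; exact hσbot.sup hσtop)
    refine ⟨σ t₀, hσpos t₀, fun R hR hlt hex => ?_, ?_, fun R hR => ?_⟩
    · obtain ⟨t, rfl⟩ := hrad R hR hex
      exact absurd (ht₀ t) (not_le.2 hlt)
    · obtain ⟨u, hu, -⟩ := hsol t₀
      exact ⟨u, hu⟩
    · obtain ⟨t₁, ht₁, he₁⟩ := hleft t₀ R hR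
      obtain ⟨s, hs1, hs2⟩ := ((hσtop.eventually (eventually_ge_atTop R)).and
        (eventually_ge_atTop t₀)).exists
      obtain ⟨t₂, ht₂, he₂⟩ := intermediate_value_Icc hs2 hσc.continuousOn ⟨hR.le, hs1⟩
      obtain ⟨u₁, hu₁, hi₁⟩ := hsol t₁
      obtain ⟨u₂, hu₂, hi₂⟩ := hsol t₂
      rw [he₁] at hu₁
      rw [he₂] at hu₂
      -- The two solutions differ at the origin, their central values being `exp t₁ < exp t₂`.
      refine ⟨u₁, u₂, hu₁, hu₂, 0, by simpa using ((hσpos t₀).trans hR).le, ?_⟩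
      rw [hi₁, hi₂, Ne, Real.exp_eq_exp]
      exact (ht₁.trans_le ht₂.1).ne
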